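/- Notation: $(a)_k=a(a+1)\cdots(a+k-1)$, $(a)_0=1$; $\binom{a}{k}=\frac{a(a-1)\cdots(a-k+1)}{k!}$ for real $a$ and integer $k\ge 0$; and $1/\Gamma(z)=0$ for $z=0,-1,-2,\ldots$. For real $\alpha>-1$ and real $x$ define, for $i\ge 1$, $$a_i(x)=\frac{1}{i!}\sum_{j=1}^i(-1)^{i+j+1}\binom{\alpha+1}{j-1}\binom{\alpha+2}{i-j}(\alpha+3)_{i-j}x^j.$$ Put $\beta_1(x)=0$ and, for $i\ge 2$, $\beta_i(x)=\beta_i^{(1)}(x)+\beta_i^{(2)}(x)+\beta_i^{(3)}(x)+\beta_i^{(4)}(x)$, where $$\beta_i^{(1)}(x)=\frac{1}{(\alpha+1)(i-2)!}\sum_{j=1}^i(-1)^{i+j+1}\binom{\alpha+2}{j-1}\binom{\alpha+3}{i-j}(\alpha+2)_{i-j}x^{j-1},$$ $$\beta_i^{(2)}(x)=\frac{2(\alpha+2)}{(\alpha+1)(i-1)!}\sum_{j=2}^i(-1)^{i+j+1}\binom{\alpha+1}{j-2}\binom{\alpha+2}{i-j}(\alpha+3)_{i-j}x^{j-2},$$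 $$\beta_i^{(3)}(x)=\frac{1}{(\alpha+1)^2(\alpha+2)(\alpha+3)^2(i-2)!}\sum_{j=0}^i(-1)^{i+j+1}\binom{\alpha+3}{j}\binom{\alpha+3}{i-j}(\alpha+1)_{i-j}\left[(\alpha+1)(\alpha+3)+j(i-j)\right]x^j,$$ $$\beta_i^{(4)}(x)=\frac{i-2}{(\alpha+1)^2(\alpha+3)(\alpha+4)^2(i-2)!}\sum_{j=0}^i(-1)^{i+j+1}\binom{\alpha+4}{j}\binom{\alpha+4}{i-j}(\alpha+1)_{i-j}\left[(\alpha+1)(\alpha+4)+j(i-j)\right]x^j.$$ For $i\ge 1$ let $\gamma_i(x)=\sum_{p=1}^5\gamma_i^{(p)}(x)$, where $$\gamma_i^{(1)}(x)=\frac{(-1)^{i+1}}{(\alpha+1)(i-1)!}\sum_{k=1}^ia_k(x)\sum_{j=k}^i(-1)^j\binom{\alpha+3}{j-k}\binom{\alpha+3}{i-j}(\alpha+4)_{i-j+k-1}x^{j-k},$$ $$\gamma_i^{(2)}(x)=\frac{(-1)^i}{(i+1)!}\sum_{k=1}^i\beta_k(x)\sum_{j=k}^i(-1)^j\binom{\alpha+1}{j-k}\binom{\alpha+1}{i-j}(\alpha+3)_{i-j+k}x^{j-k},$$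 $$\gamma_i^{(3)}(x)=\frac{2}{(\alpha+1)(\alpha+3)}\sum_{j=0}^i\sum_{n=0}^j(-1)^j\frac{(-j)_n(\alpha+3)_{i-j+n}(\alpha+3)_n}{j!\,(i-j)!\,n!}\left[\sum_{k=0}^{i-j}\frac{(-i+j)_k(n+\alpha+3)_k(n+\alpha+4)_k}{\Gamma(n+k)\Gamma(n+k+2)k!}\right]x^j,$$ $$\gamma_i^{(4)}(x)=-\frac{2}{(\alpha+1)(\alpha+4)}\sum_{j=0}^i\sum_{n=0}^j(-1)^j\frac{(-j)_n(\alpha+3)_{i-j+n}(\alpha+4)_n}{j!\,(i-j)!\,n!}\left[\sum_{k=0}^{i-j}\frac{(-i+j)_k(n+\alpha+3)_k(n+\alpha+4)_k}{\Gamma(n+k)\Gamma(n+k+2)k!}\right]x^j,$$ $$\gamma_i^{(5)}(x)=\frac{(-1)^{i+1}}{(\alpha+1)(\alpha+3)}\sum_{k=0}^{i-1}(-1)^k\frac{(-\alpha-2)_k(\alpha+3)_k}{(2)_k(\alpha+4)_k\,k!}\,\frac{1}{\Gamma(i-k)}\sum_{j=0}^i(-1)^j\binom{k+\alpha+3}{j}\binom{k+\alpha+3}{i-j}(\alpha+3)_{i-j}x^j.$$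 Theorem. Let $\alpha\in\{0,1,2,\ldots\}$. Then for all real $x$: 1. $\gamma_i(x)=0$ for every $i>4\alpha+10$; 2. $\displaystyle\gamma_{4\alpha+10}(x)=\gamma_{4\alpha+10}^{(5)}(x)=\frac{x^{2\alpha+5}}{(\alpha+1)(2\alpha+5)(\alpha+2)!\,(\alpha+3)!}$; 3. $\displaystyle\sum_{i=1}^{\infty}\gamma_i(x)=\sum_{i=1}^{4\alpha+10}\gamma_i(x)=0$. -/

import Mathlib

noncomputable section

namespace SobolevLaguerre

open Finset

/-- The shifted factorial `(a)_k = a (a + 1) ⋯ (a + k - 1)`, with `(a)_0 = 1`. -/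
def poch (a : ℝ) (k : ℕ) : ℝ := (ascPochhammer ℝ k).eval a

/-- The generalized binomial coefficient `a (a - 1) ⋯ (a - k + 1) / k!` with real upper entry. -/
def binom (a : ℝ) (k : ℕ) : ℝ := Ring.choose a k

/-- The entire function `1 / Γ`; it vanishes at `0, -1, -2, …`, which agrees with
`Real.Gamma` being `0` there and with `0⁻¹ = 0`. -/
def invGamma (z : ℝ) : ℝ := (Real.Gamma z)⁻¹

/-- The coefficient `a_i(x)`, for `i ≥ 1`. -/
def aCoeff (α : ℝ) (i : ℕ) (x : ℝ) : ℝ :=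
  1 / (i.factorial : ℝ) * ∑ j ∈ Icc 1 i,
    (-1) ^ (i + j + 1) * binom (α + 1) (j - 1) * binom (α + 2) (i - j) *
      poch (α + 3) (i - j) * x ^ j

/-- The first part of `β_i(x)`, for `i ≥ 2`. -/
def betaCoeff1 (α : ℝ) (i : ℕ) (x : ℝ) : ℝ :=
  1 / ((α + 1) * ((i - 2).factorial : ℝ)) * ∑ j ∈ Icc 1 i,
    (-1) ^ (i + j + 1) * binom (α + 2) (j - 1) * binom (α + 3) (i - j) *
      poch (α + 2) (i - j) * x ^ (j - 1)

/-- The second part of `β_i(x)`, for `i ≥ 2`. -/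
def betaCoeff2 (α : ℝ) (i : ℕ) (x : ℝ) : ℝ :=
  2 * (α + 2) / ((α + 1) * ((i - 1).factorial : ℝ)) * ∑ j ∈ Icc 2 i,
    (-1) ^ (i + j + 1) * binom (α + 1) (j - 2) * binom (α + 2) (i - j) *
      poch (α + 3) (i - j) * x ^ (j - 2)

/-- The third part of `β_i(x)`, for `i ≥ 2`. -/
def betaCoeff3 (α : ℝ) (i : ℕ) (x : ℝ) : ℝ :=
  1 / ((α + 1) ^ 2 * (α + 2) * (α + 3) ^ 2 * ((i - 2).factorial : ℝ)) * ∑ j ∈ Icc 0 i,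
    (-1) ^ (i + j + 1) * binom (α + 3) j * binom (α + 3) (i - j) * poch (α + 1) (i - j) *
      ((α + 1) * (α + 3) + (j : ℝ) * ((i : ℝ) - (j : ℝ))) * x ^ j

/-- The fourth part of `β_i(x)`, for `i ≥ 2`. -/
def betaCoeff4 (α : ℝ) (i : ℕ) (x : ℝ) : ℝ :=
  ((i : ℝ) - 2) / ((α + 1) ^ 2 * (α + 3) * (α + 4) ^ 2 * ((i - 2).factorial : ℝ)) *
    ∑ j ∈ Icc 0 i,
      (-1) ^ (i + j + 1) * binom (α + 4) j * binom (α + 4) (i - j) * poch (α + 1) (i - j) *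
        ((α + 1) * (α + 4) + (j : ℝ) * ((i : ℝ) - (j : ℝ))) * x ^ j

/-- The coefficient `β_i(x)`, for `i ≥ 1`; here `β_1(x) = 0`. -/
def betaCoeff (α : ℝ) (i : ℕ) (x : ℝ) : ℝ :=
  if i ≤ 1 then 0
  else betaCoeff1 α i x + betaCoeff2 α i x + betaCoeff3 α i x + betaCoeff4 α i x

/-- The first part of `γ_i(x)`, for `i ≥ 1`. -/
def gammaCoeff1 (α : ℝ) (i : ℕ) (x : ℝ) : ℝ :=
  (-1) ^ (i + 1) / ((α + 1) * ((i - 1).factorial : ℝ)) * ∑ k ∈ Icc 1 i, aCoeff α k x *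
    ∑ j ∈ Icc k i, (-1) ^ j * binom (α + 3) (j - k) * binom (α + 3) (i - j) *
      poch (α + 4) (i - j + k - 1) * x ^ (j - k)

/-- The second part of `γ_i(x)`, for `i ≥ 1`. -/
def gammaCoeff2 (α : ℝ) (i : ℕ) (x : ℝ) : ℝ :=
  (-1) ^ i / ((i + 1).factorial : ℝ) * ∑ k ∈ Icc 1 i, betaCoeff α k x *
    ∑ j ∈ Icc k i, (-1) ^ j * binom (α + 1) (j - k) * binom (α + 1) (i - j) *
      poch (α + 3) (i - j + k) * x ^ (j - k)

/-- The third part of `γ_i(x)`, for `i ≥ 1`. -/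
def gammaCoeff3 (α : ℝ) (i : ℕ) (x : ℝ) : ℝ :=
  2 / ((α + 1) * (α + 3)) * ∑ j ∈ Icc 0 i, ∑ n ∈ Icc 0 j,
    (-1) ^ j * (poch (-(j : ℝ)) n * poch (α + 3) (i - j + n) * poch (α + 3) n) /
        ((j.factorial : ℝ) * ((i - j).factorial : ℝ) * (n.factorial : ℝ)) *
      (∑ k ∈ Icc 0 (i - j),
        poch (-(i : ℝ) + (j : ℝ)) k * poch ((n : ℝ) + α + 3) k * poch ((n : ℝ) + α + 4) k *
          invGamma ((n : ℝ) + (k : ℝ)) * invGamma ((n : ℝ) + (k : ℝ) + 2) /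
          (k.factorial : ℝ)) *
      x ^ j

/-- The fourth part of `γ_i(x)`, for `i ≥ 1`. -/
def gammaCoeff4 (α : ℝ) (i : ℕ) (x : ℝ) : ℝ :=
  -(2 / ((α + 1) * (α + 4))) * ∑ j ∈ Icc 0 i, ∑ n ∈ Icc 0 j,
    (-1) ^ j * (poch (-(j : ℝ)) n * poch (α + 3) (i - j + n) * poch (α + 4) n) /
        ((j.factorial : ℝ) * ((i - j).factorial : ℝ) * (n.factorial : ℝ)) *
      (∑ k ∈ Icc 0 (i - j),
        poch (-(i : ℝ) + (j : ℝ)) k * poch ((n : ℝ) + α + 3) k * poch ((n : ℝ) + α + 4) k *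
          invGamma ((n : ℝ) + (k : ℝ)) * invGamma ((n : ℝ) + (k : ℝ) + 2) /
          (k.factorial : ℝ)) *
      x ^ j

/-- The fifth part of `γ_i(x)`, for `i ≥ 1`; the outer sum is over `0 ≤ k ≤ i - 1`. -/
def gammaCoeff5 (α : ℝ) (i : ℕ) (x : ℝ) : ℝ :=
  (-1) ^ (i + 1) / ((α + 1) * (α + 3)) * ∑ k ∈ range i,
    (-1) ^ k * (poch (-α - 2) k * poch (α + 3) k) /
        (poch 2 k * poch (α + 4) k * (k.factorial : ℝ)) *
      invGamma ((i : ℝ) - (k : ℝ)) *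
      ∑ j ∈ Icc 0 i, (-1) ^ j * binom ((k : ℝ) + α + 3) j * binom ((k : ℝ) + α + 3) (i - j) *
        poch (α + 3) (i - j) * x ^ j

/-- The coefficient `γ_i(x)`, for `i ≥ 1`. -/
def gammaCoeff (α : ℝ) (i : ℕ) (x : ℝ) : ℝ :=
  gammaCoeff1 α i x + gammaCoeff2 α i x + gammaCoeff3 α i x + gammaCoeff4 α i x +
    gammaCoeff5 α i x

end SobolevLaguerre

end

/-! For a natural number $\alpha=a$ every coefficient is a sum, along a diagonal $j+v=i$, of an
array supported in a finite box $[0,A]\times[0,B]$ (for $\gamma^{(1)},\gamma^{(2)}$ a convolution of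
two such sums, for $\gamma^{(5)}$ a finite combination of them). Hence it vanishes for $i>A+B$,
equals the corner entry at $i=A+B$, and summing over all $i$ sums the whole box, in any order.

The box sums reduce to one principle: $\sum_v(-1)^v\binom nv P(v)$ is $0$ if $\deg P<n$ and $(-1)^n
n!$ if $P$ is monic of degree $n$ (`sum_alternating_choose_eval`). With natural parameters,
quotients $(A+v)!/(j+v-s)!$ are falling factorials in $v$ (`factorial_mul_recipFact`). This gives
$\sum a_i=\sum\beta_i=0$. In $\gamma^{(1)},\gamma^{(2)}$ the kernel attached to $a_k$ or $\beta_k$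
has total mass independent of $k$, so their sums over $i$ vanish too. For $\gamma^{(5)}$ the box
sums leave an alternating sum over $k$ of a polynomial of too small a degree.

In $\gamma^{(3)},\gamma^{(4)}$ the innermost sum is an $N$-th difference, $N=i-j$, of a monic
polynomial $R$ of degree $2a+5$ (`ratioPoly`), and the sum over $n$ is a $j$-th difference, so both
indices are bounded. Summing over $N$ is Newton's formula, whose value $R(-a-3)$ is $0$
(`sum_diffTerm`).

At $i=4a+10$, in units of $x^{2a+5}/((a+1)(a+2)!(a+3)!)$, the parts 1 to 4 are $-1$,
$\frac{a+2}{a+4}$, $0$, $\frac2{a+4}$. They cancel, and part 5 remains. -/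

namespace SobolevLaguerre

open Finset Polynomial

/-! ### Sums along diagonals -/

/-- The sum of `f k w` over the diagonal `k + w = i`. -/
noncomputable def diagSum (f : ℕ → ℕ → ℝ) (i : ℕ) : ℝ := ∑ k ∈ range (i + 1), f k (i - k)

theorem diagSum_eq_zero {f : ℕ → ℕ → ℝ} {A B i : ℕ} (hA : ∀ k w, A < k → f k w = 0)
    (hB : ∀ k w, B < w → f k w = 0) (hi : A + B < i) : diagSum f i = 0 := by
  refine sum_eq_zero fun k hk => ?_
  rcases lt_or_ge A k with h | h
  · exact hA _ _ h
  · exact hB _ _ (by omega)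

theorem diagSum_add_eq {f : ℕ → ℕ → ℝ} {A B : ℕ} (hA : ∀ k w, A < k → f k w = 0)
    (hB : ∀ k w, B < w → f k w = 0) : diagSum f (A + B) = f A B := by
  unfold diagSum
  rw [sum_eq_single A, Nat.add_sub_cancel_left]
  · intro k hk hne
    rcases lt_or_gt_of_ne hne with h | h
    · exact hB _ _ (by omega)
    · exact hA _ _ h
  · intro h
    simp at h

/-- The diagonals below `M` cover the whole box that carries `f`; what else they meet is zero. -/
theorem sum_range_diagSum {f : ℕ → ℕ → ℝ} {A B M : ℕ} (hA : ∀ k w, A < k → f k w = 0)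
    (hB : ∀ k w, B < w → f k w = 0) (hM : A + B < M) :
    ∑ i ∈ range M, diagSum f i = ∑ k ∈ range (A + 1), ∑ w ∈ range (B + 1), f k w := by
  unfold diagSum
  rw [sum_range_diag_flip]
  symm
  calc ∑ k ∈ range (A + 1), ∑ w ∈ range (B + 1), f k w
      = ∑ k ∈ range (A + 1), ∑ w ∈ range (M - k), f k w := by
        refine sum_congr rfl fun k hk => sum_subset ?_ fun w _ hw => hB _ _ ?_
        · rw [mem_range] at hk
          exact range_subset_range.2 (by omega)
        · simpa using hw
    _ = _ := by
        refine sum_subset (range_subset_range.2 (by omega)) fun k _ hk => ?_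
        exact sum_eq_zero fun w _ => hA _ _ (by simpa using hk)

theorem sum_Icc_eq_diagSum {g : ℕ → ℝ} {f : ℕ → ℕ → ℝ} {i : ℕ}
    (h : ∀ j v, j + v = i → g j = f j v) : ∑ j ∈ Icc 0 i, g j = diagSum f i := by
  have hI : Icc 0 i = range (i + 1) := by
    ext j
    simp
  rw [hI]
  refine sum_congr rfl fun j hj => h _ _ ?_
  rw [mem_range] at hj
  omega

theorem sum_Icc_shift_eq_diagSum {g : ℕ → ℝ} {f : ℕ → ℕ → ℝ} {k w : ℕ}
    (h : ∀ u v, u + v = w → g (k + u) = f u v) : ∑ j ∈ Icc k (k + w), g j = diagSum f w := by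
  have hI : Icc k (k + w) = Ico k (k + w + 1) := by
    ext j
    simp
  rw [hI, sum_Ico_eq_sum_range, show k + w + 1 - k = w + 1 by omega]
  refine sum_congr rfl fun j hj => h _ _ ?_
  rw [mem_range] at hj
  omega

/-- Serves sums whose index starts at 1 or 2: the array is extended by zero to smaller indices. -/
theorem sum_Icc_eq_diagSum_of_zero {g : ℕ → ℝ} {f : ℕ → ℕ → ℝ} {m i : ℕ}
    (h : ∀ j v, m ≤ j → j + v = i → g j = f j v) (h0 : ∀ j v, j < m → f j v = 0) :
    ∑ j ∈ Icc m i, g j = diagSum f i := by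
  calc ∑ j ∈ Icc m i, g j = ∑ j ∈ Icc m i, f j (i - j) := by
        refine sum_congr rfl fun j hj => ?_
        rw [mem_Icc] at hj
        exact h _ _ hj.1 (by omega)
    _ = _ := by
        refine sum_subset (fun j hj => ?_) fun j hj hj' => h0 _ _ ?_
        · rw [mem_Icc] at hj
          rw [mem_range]
          omega
        · rw [mem_range] at hj
          rw [mem_Icc] at hj'
          omega

/-! ### Backward differences of polynomials -/

/-- The operator `p ↦ p(X) - p(X + 1)`. -/
noncomputable def negDiff (p : ℝ[X]) : ℝ[X] := p - taylor 1 p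

theorem negDiff_eval (p : ℝ[X]) (t : ℝ) : (negDiff p).eval t = p.eval t - p.eval (t + 1) := by
  simp [negDiff, taylor_eval]

/-- The leading terms cancel. A strict bound on `degree` can descend to `0`, where it forces the
zero polynomial; `natDegree` could not express this. -/
theorem degree_negDiff_lt {p : ℝ[X]} {d : ℕ} (h : p.degree < (d + 1 : ℕ)) :
    (negDiff p).degree < d := by
  by_cases hp : p = 0
  · subst hp
    simp [negDiff]
  · have h1 : (negDiff p).degree < p.degree :=
      degree_sub_lt_left (degree_taylor p 1).symm hp (leadingCoeff_taylor 1 p).symm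
    rw [degree_eq_natDegree hp] at h h1
    refine lt_of_lt_of_le h1 ?_
    exact_mod_cast Nat.lt_succ_iff.1 (by exact_mod_cast h)

theorem degree_negDiff_iterate_lt {p : ℝ[X]} {d N : ℕ} (h : p.degree < (d + N : ℕ)) :
    (negDiff^[N] p).degree < d := by
  induction N generalizing p with
  | zero => simpa using h
  | succ N ih => exact ih (degree_negDiff_lt h)

theorem negDiff_iterate_eval (p : ℝ[X]) (N : ℕ) (t : ℝ) :
    (negDiff^[N] p).eval t =
      ∑ k ∈ range (N + 1), (-1 : ℝ) ^ k * (N.choose k : ℝ) * p.eval (t + k) := by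
  have h : ∀ (N : ℕ) (p : ℝ[X]), (fun t => (negDiff^[N] p).eval t) =
      (-1 : ℝ) ^ N • (fwdDiff (1 : ℝ))^[N] p.eval := by
    intro N
    induction N with
    | zero => intro p; simp
    | succ N ih =>
      intro p
      have h1 : (fun t => (negDiff p).eval t) = (-1 : ℝ) • fwdDiff (1 : ℝ) p.eval := by
        ext t
        simp [negDiff_eval, fwdDiff]
      rw [Function.iterate_succ_apply, ih, Function.iterate_succ_apply, pow_succ]
      change (-1 : ℝ) ^ N • (fwdDiff (1 : ℝ))^[N] (fun t => (negDiff p).eval t) = _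
      rw [h1, fwdDiff_iter_const_smul, smul_smul]
  have h2 := congrFun (h N p) t
  simp only [Pi.smul_apply, smul_eq_mul] at h2
  rw [h2, fwdDiff_iter_eq_sum_shift, mul_sum]
  refine sum_congr rfl fun k hk => ?_
  rw [mem_range] at hk
  obtain ⟨m, rfl⟩ := Nat.exists_eq_add_of_le (Nat.lt_succ_iff.1 hk)
  -- With $N=k+m$, the sign $(-1)^m$ of the forward difference and the prefactor $(-1)^N$ combine to
  -- $(-1)^k$.
  have h3 : ((-1 : ℝ) ^ m) * (-1) ^ m = 1 := by rw [← mul_pow]; simp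
  simp only [Nat.add_sub_cancel_left, zsmul_eq_mul, nsmul_eq_mul, mul_one]
  push_cast
  rw [pow_add]
  linear_combination (-1 : ℝ) ^ k * ((k + m).choose k : ℝ) * p.eval (t + k) * h3

/-- Up to sign the sum is the $n$-th difference of `p` at $0$, which sees only the coefficient of
$X^n$. -/
theorem sum_alternating_choose_eval {p : ℝ[X]} {n : ℕ} (h : p.natDegree ≤ n) :
    ∑ k ∈ range (n + 1), (-1 : ℝ) ^ k * (n.choose k : ℝ) * p.eval (k : ℝ) =
      (-1) ^ n * (n.factorial : ℝ) * p.coeff n := by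
  have h0 := fwdDiff_iter_eq_sum_shift (1 : ℝ) p.eval n 0
  have h1 : (fwdDiff (1 : ℝ))^[n] p.eval 0 = (n.factorial : ℝ) * p.coeff n := by
    rcases h.lt_or_eq with h | h
    · rw [fwdDiff_iter_eq_zero_of_degree_lt h, coeff_eq_zero_of_natDegree_lt h]
      simp
    · subst h
      rw [fwdDiff_iter_degree_eq_factorial]
      simp [mul_comm]
  rw [h1] at h0
  rw [mul_assoc, h0, mul_sum]
  refine sum_congr rfl fun k hk => ?_
  rw [mem_range] at hk
  obtain ⟨m, rfl⟩ := Nat.exists_eq_add_of_le (Nat.lt_succ_iff.1 hk)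
  have h3 : ((-1 : ℝ) ^ m) * (-1) ^ m = 1 := by rw [← mul_pow]; simp
  simp only [Nat.add_sub_cancel_left, zsmul_eq_mul, nsmul_eq_mul, mul_one, zero_add]
  push_cast
  rw [pow_add]
  linear_combination -(-1 : ℝ) ^ k * ((k + m).choose k : ℝ) * p.eval (k : ℝ) * h3

/-- Newton's backward difference formula. -/
theorem sum_choose_negDiff_iterate_eval (B a : ℕ) {p : ℝ[X]} (h : p.degree < (B : ℕ)) (t : ℝ) :
    ∑ N ∈ range B, ((a + N).choose N : ℝ) * (negDiff^[N] p).eval t = p.eval (t - a - 1) := by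
  -- With $E$ the unit shift and $D=1-E$, formally $\sum_N\binom{a+N}{N}D^N=(1-D)^{-a-1}=E^{-a-1}$.
  -- The proof is a double induction, on the degree bound and then on `a`.
  induction B generalizing p a t with
  | zero =>
    have : p = 0 := by simpa using h
    simp [this]
  | succ B ih =>
    have hd := degree_negDiff_lt h
    induction a with
    | zero =>
      have h1 := ih 0 hd t
      simp only [zero_add, Nat.choose_self, Nat.cast_one, one_mul, Nat.cast_zero, sub_zero] at h1 ⊢
      rw [sum_range_succ']
      simp only [Function.iterate_succ_apply, Function.iterate_zero, id]
      rw [h1, negDiff_eval]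
      ring_nf
    | succ a iha =>
      have h1 := ih (a + 1) hd t
      rw [sum_range_succ'] at iha ⊢
      -- Pascal's rule: the first summand gives the sum for `a`, the second the sum for `a + 1`
      -- applied to `negDiff p`, whose degree is smaller.
      have h2 : ∀ N, (((a + 1 + (N + 1)).choose (N + 1) : ℕ) : ℝ) =
          ((a + (N + 1)).choose (N + 1) : ℝ) + ((a + 1 + N).choose N : ℝ) := by
        intro N
        rw [show a + 1 + (N + 1) = (a + 1 + N) + 1 by ring, Nat.choose_succ_succ,
          show a + (N + 1) = a + 1 + N by ring]
        push_cast
        ring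
      simp only [h2, add_mul, sum_add_distrib]
      simp only [Function.iterate_succ_apply] at iha ⊢
      rw [h1, negDiff_eval]
      simp only [Nat.choose_zero_right] at iha ⊢
      push_cast at iha ⊢
      rw [show t - (a + 1) - 1 + 1 = t - a - 1 by ring]
      linarith

/-! ### Falling factorials -/

/-- The polynomial `(X + A) (X + A - 1) ⋯ (X + A - d + 1)`. -/
noncomputable def fallPoly (A d : ℕ) : ℝ[X] := taylor (A : ℝ) (descPochhammer ℝ d)

theorem fallPoly_eval (A d m : ℕ) :
    (fallPoly A d).eval (m : ℝ) = ((m + A).descFactorial d : ℝ) := by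
  rw [fallPoly, taylor_eval, ← Nat.cast_add, descPochhammer_eval_eq_descFactorial]

theorem natDegree_fallPoly (A d : ℕ) : (fallPoly A d).natDegree = d := by
  rw [fallPoly, natDegree_taylor, descPochhammer_natDegree]

theorem monic_fallPoly (A d : ℕ) : (fallPoly A d).Monic := by
  rw [fallPoly, Monic, leadingCoeff_taylor]
  exact monic_descPochhammer ℝ d

theorem sum_alternating_choose_descFactorial_self (n A : ℕ) :
    ∑ v ∈ range (n + 1), (-1 : ℝ) ^ v * (n.choose v : ℝ) * ((v + A).descFactorial n : ℝ) =
      (-1) ^ n * (n.factorial : ℝ) := by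
  have h := sum_alternating_choose_eval (natDegree_fallPoly A n).le
  have h1 : (fallPoly A n).coeff n = 1 := by
    have := (monic_fallPoly A n).coeff_natDegree
    rwa [natDegree_fallPoly] at this
  simpa only [fallPoly_eval, h1, mul_one] using h

theorem sum_alternating_choose_descFactorial_of_lt {n d : ℕ} (A : ℕ) (hd : d < n) :
    ∑ v ∈ range (n + 1), (-1 : ℝ) ^ v * (n.choose v : ℝ) * ((v + A).descFactorial d : ℝ) = 0 := by
  have h := sum_alternating_choose_eval ((natDegree_fallPoly A d).trans_le hd.le)
  rw [coeff_eq_zero_of_natDegree_lt ((natDegree_fallPoly A d).trans_lt hd), mul_zero] at h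
  simpa only [fallPoly_eval] using h

/-- The number `1 / (b - s)!`, read as `0` for `b < s`. -/
noncomputable def recipFact (s b : ℕ) : ℝ := (b.descFactorial s : ℝ) / (b.factorial : ℝ)

theorem recipFact_add (s b : ℕ) : recipFact s (s + b) = 1 / (b.factorial : ℝ) := by
  have h := Nat.factorial_mul_descFactorial (Nat.le_add_right s b)
  rw [Nat.add_sub_cancel_left] at h
  rw [recipFact, ← h]
  have := (s + b).factorial_ne_zero
  rw [← h] at this
  push_cast
  have h1 : (b.factorial : ℝ) ≠ 0 := by positivity
  have h2 : ((s + b).descFactorial s : ℝ) ≠ 0 := by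
    exact_mod_cast right_ne_zero_of_mul this
  field_simp

theorem recipFact_of_lt {s b : ℕ} (h : b < s) : recipFact s b = 0 := by
  simp [recipFact, Nat.descFactorial_of_lt h]

/-- Both sides are $a!/(a-d)!$ since $a-d=b-s$. When $b<s$, also $d>a$, so the conventions for
$1/(b-s)!$ and for the falling factorial agree on $0$. -/
theorem factorial_mul_recipFact {a s b d : ℕ} (h : a + s = b + d) :
    (a.factorial : ℝ) * recipFact s b = (a.descFactorial d : ℝ) := by
  rcases lt_or_ge b s with hb | hb
  · rw [recipFact_of_lt hb, Nat.descFactorial_of_lt (by omega)]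
    simp
  · obtain ⟨c, rfl⟩ := Nat.exists_eq_add_of_le hb
    obtain rfl : a = d + c := by omega
    have h1 := Nat.factorial_mul_descFactorial (Nat.le_add_right d c)
    rw [Nat.add_sub_cancel_left] at h1
    rw [recipFact_add, ← h1]
    have h2 : (c.factorial : ℝ) ≠ 0 := by positivity
    push_cast
    field_simp

theorem recipFact_zero (b : ℕ) : recipFact 0 b = 1 / (b.factorial : ℝ) := by
  simp [recipFact]

/-! ### The special functions at natural arguments -/

theorem poch_natCast_add_one (m k : ℕ) :
    poch ((m : ℝ) + 1) k = ((m + k).factorial : ℝ) / (m.factorial : ℝ) := by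
  have h : poch ((m : ℝ) + 1) k = (((m + 1).ascFactorial k : ℕ) : ℝ) := by
    rw [poch, ← Nat.cast_succ, ascPochhammer_nat_eq_natCast_ascFactorial]
  rw [h, eq_div_iff (by positivity), mul_comm]
  exact_mod_cast Nat.factorial_mul_ascFactorial m k

theorem binom_natCast (m k : ℕ) : binom (m : ℝ) k = (m.choose k : ℝ) := by
  rw [binom, Ring.choose_natCast]

theorem poch_neg_natCast (m k : ℕ) :
    poch (-(m : ℝ)) k = (-1) ^ k * (k.factorial : ℝ) * (m.choose k : ℝ) := by
  rw [poch, ascPochhammer_eval_neg_eq_descPochhammer, descPochhammer_eval_eq_descFactorial,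
    Nat.descFactorial_eq_factorial_mul_choose]
  push_cast
  ring

theorem invGamma_natCast_add_one (m : ℕ) : invGamma ((m : ℝ) + 1) = 1 / (m.factorial : ℝ) := by
  rw [invGamma, Real.Gamma_nat_eq_factorial, one_div]

theorem invGamma_sub (i k : ℕ) : invGamma ((i : ℝ) - k) = recipFact (k + 1) i := by
  rcases lt_or_ge k i with h | h
  · obtain ⟨c, rfl⟩ := Nat.exists_eq_add_of_lt h
    rw [show k + c + 1 = k + 1 + c by ring, recipFact_add, ← invGamma_natCast_add_one]
    congr 1
    push_cast
    ring
  · rw [recipFact_of_lt (by omega), invGamma]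
    obtain ⟨c, rfl⟩ := Nat.exists_eq_add_of_le h
    push_cast
    rw [show (i : ℝ) - (i + c) = -(c : ℝ) by ring, Real.Gamma_neg_nat_eq_zero, inv_zero]

theorem invGamma_natCast (m : ℕ) : invGamma (m : ℝ) = recipFact 1 m := by
  have := invGamma_sub m 0
  simpa using this

theorem neg_one_pow_add_self (j v : ℕ) : (-1 : ℝ) ^ (j + j + v) = (-1) ^ v := by
  rw [pow_add, Even.neg_one_pow ⟨j, rfl⟩, one_mul]

/-- The quotient is a polynomial in `v` of degree $A+s-j$: `h1` makes this nonnegative, `h2` makes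
it less than `n`. -/
theorem factorial_mul_recipFact_sum {n A s j : ℕ} (h1 : j ≤ A + s) (h2 : A + s < j + n) :
    ∑ v ∈ range (n + 1), (-1 : ℝ) ^ v * (n.choose v : ℝ) *
      (((A + v).factorial : ℝ) * recipFact s (j + v)) = 0 := by
  obtain ⟨d, hd⟩ := Nat.exists_eq_add_of_le h1
  rw [← sum_alternating_choose_descFactorial_of_lt (n := n) (d := d) A (by omega)]
  refine sum_congr rfl fun v _ => ?_
  rw [factorial_mul_recipFact (d := d) (by omega), add_comm A v]

theorem factorial_mul_recipFact_sum_self {n A s j : ℕ} (h : A + s = j + n) :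
    ∑ v ∈ range (n + 1), (-1 : ℝ) ^ v * (n.choose v : ℝ) *
      (((A + v).factorial : ℝ) * recipFact s (j + v)) = (-1) ^ n * (n.factorial : ℝ) := by
  rw [← sum_alternating_choose_descFactorial_self n A]
  refine sum_congr rfl fun v _ => ?_
  rw [factorial_mul_recipFact (d := n) (by omega), add_comm A v]

theorem factorial_mul_recipFact_linear_sum {n a s j : ℕ} (hn : n = a + s + 1) (hj : j ≤ n) :
    ∑ v ∈ range (n + 1), (-1 : ℝ) ^ v * (n.choose v : ℝ) *
      ((((a + v).factorial : ℝ) * recipFact s (j + v)) *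
        (((a : ℝ) + 1) * n + (j : ℝ) * v)) = 0 := by
  -- Write $(a+1)n+jv=j(a+1+v)+(a+1)(n-j)$ and absorb $a+1+v$ into the factorial. The degree
  -- conditions fail only at $j=0$ for the first sum and at $j=n$ for the second, where the
  -- coefficients $j$ and $n-j$ vanish.
  have key : ∀ v : ℕ, (-1 : ℝ) ^ v * (n.choose v : ℝ) *
      ((((a + v).factorial : ℝ) * recipFact s (j + v)) * (((a : ℝ) + 1) * n + (j : ℝ) * v)) =
      (j : ℝ) * ((-1 : ℝ) ^ v * (n.choose v : ℝ) *
        (((a + 1 + v).factorial : ℝ) * recipFact s (j + v))) +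
      ((a : ℝ) + 1) * ((n : ℝ) - j) * ((-1 : ℝ) ^ v * (n.choose v : ℝ) *
        (((a + v).factorial : ℝ) * recipFact s (j + v))) := by
    intro v
    rw [show a + 1 + v = (a + v) + 1 by ring, Nat.factorial_succ]
    push_cast
    ring
  simp only [key, sum_add_distrib, ← mul_sum]
  have h1 : (j : ℝ) * ∑ v ∈ range (n + 1), (-1 : ℝ) ^ v * (n.choose v : ℝ) *
      (((a + 1 + v).factorial : ℝ) * recipFact s (j + v)) = 0 := by
    rcases Nat.eq_zero_or_pos j with h | h
    · simp [h]
    · rw [factorial_mul_recipFact_sum (by omega) (by omega), mul_zero]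
  have h2 : ((a : ℝ) + 1) * ((n : ℝ) - j) * ∑ v ∈ range (n + 1), (-1 : ℝ) ^ v *
      (n.choose v : ℝ) * (((a + v).factorial : ℝ) * recipFact s (j + v)) = 0 := by
    rcases hj.eq_or_lt with h | h
    · simp [h]
    · rw [factorial_mul_recipFact_sum (by omega) (by omega), mul_zero]
  rw [h1, h2, add_zero]

theorem recipFact_succ {s b : ℕ} (h : s ≤ b) :
    recipFact (s + 1) b = ((b : ℝ) - s) * recipFact s b := by
  rw [recipFact, recipFact, Nat.descFactorial_succ, Nat.cast_mul, Nat.cast_sub h, mul_div_assoc]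

theorem recipFact_eq {s b : ℕ} (h : s ≤ b) : recipFact s b = 1 / ((b - s).factorial : ℝ) := by
  obtain ⟨c, rfl⟩ := Nat.exists_eq_add_of_le h
  rw [recipFact_add, Nat.add_sub_cancel_left]

theorem poch_one (a k : ℕ) :
    poch ((a : ℝ) + 1) k = ((a + k).factorial : ℝ) / (a.factorial : ℝ) :=
  poch_natCast_add_one a k

theorem poch_two (a k : ℕ) :
    poch ((a : ℝ) + 2) k = ((a + 1 + k).factorial : ℝ) / ((a + 1).factorial : ℝ) := by
  rw [← poch_natCast_add_one]
  congr 1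
  push_cast
  ring

theorem poch_three (a k : ℕ) :
    poch ((a : ℝ) + 3) k = ((a + 2 + k).factorial : ℝ) / ((a + 2).factorial : ℝ) := by
  rw [← poch_natCast_add_one]
  congr 1
  push_cast
  ring

theorem poch_four (a k : ℕ) :
    poch ((a : ℝ) + 4) k = ((a + 3 + k).factorial : ℝ) / ((a + 3).factorial : ℝ) := by
  rw [← poch_natCast_add_one]
  congr 1
  push_cast
  ring

theorem binom_one (a k : ℕ) : binom ((a : ℝ) + 1) k = ((a + 1).choose k : ℝ) := by
  rw [← binom_natCast]
  norm_cast

theorem binom_two (a k : ℕ) : binom ((a : ℝ) + 2) k = ((a + 2).choose k : ℝ) := by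
  rw [← binom_natCast]
  norm_cast

theorem binom_three (a k : ℕ) : binom ((a : ℝ) + 3) k = ((a + 3).choose k : ℝ) := by
  rw [← binom_natCast]
  norm_cast

theorem binom_four (a k : ℕ) : binom ((a : ℝ) + 4) k = ((a + 4).choose k : ℝ) := by
  rw [← binom_natCast]
  norm_cast

theorem neg_one_pow_diag (j v : ℕ) : (-1 : ℝ) ^ (j + v + j + 1) = (-1) ^ (v + 1) := by
  rw [show j + v + j + 1 = j + j + (v + 1) by ring, neg_one_pow_add_self]

/-! ### The coefficients `a_i` -/

/-- The summand of `a_{j+v}` with index `j`. -/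
noncomputable def aTerm (a : ℕ) (x : ℝ) (j v : ℕ) : ℝ :=
  if j = 0 then 0 else
    recipFact 0 (j + v) * ((-1) ^ (v + 1) * ((a + 1).choose (j - 1) : ℝ) * ((a + 2).choose v : ℝ) *
      (((a + 2 + v).factorial : ℝ) / ((a + 2).factorial : ℝ)) * x ^ j)

theorem aCoeff_eq_diagSum (a i : ℕ) (x : ℝ) : aCoeff a i x = diagSum (aTerm a x) i := by
  rw [aCoeff, mul_sum]
  refine sum_Icc_eq_diagSum_of_zero (fun j v hj h => ?_) fun j v hj => ?_
  · subst h
    rw [aTerm, if_neg (by omega), recipFact_zero, Nat.add_sub_cancel_left, binom_one, binom_two,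
      poch_three, neg_one_pow_diag]
  · rw [aTerm, if_pos (by omega)]

theorem aTerm_of_left_lt {a : ℕ} (x : ℝ) (j v : ℕ) (h : a + 2 < j) : aTerm a x j v = 0 := by
  simp [aTerm, Nat.choose_eq_zero_of_lt (show a + 1 < j - 1 by omega)]

theorem aTerm_of_right_lt {a : ℕ} (x : ℝ) (j v : ℕ) (h : a + 2 < v) : aTerm a x j v = 0 := by
  simp [aTerm, Nat.choose_eq_zero_of_lt h]

theorem aCoeff_zero (a : ℕ) (x : ℝ) : aCoeff a 0 x = 0 := by
  simp [aCoeff]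

theorem aCoeff_eq_zero {a i : ℕ} (x : ℝ) (h : 2 * a + 4 < i) : aCoeff a i x = 0 := by
  rw [aCoeff_eq_diagSum]
  exact diagSum_eq_zero (aTerm_of_left_lt x) (aTerm_of_right_lt x) (by omega)

theorem aCoeff_top (a : ℕ) (x : ℝ) :
    aCoeff a (2 * a + 4) x =
      (-1) ^ (a + 3) / ((a + 2).factorial : ℝ) * x ^ (a + 2) := by
  rw [aCoeff_eq_diagSum, show 2 * a + 4 = (a + 2) + (a + 2) by ring,
    diagSum_add_eq (aTerm_of_left_lt x) (aTerm_of_right_lt x), aTerm, if_neg (by omega),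
    recipFact_zero]
  have h : (((a + 2) + (a + 2)).factorial : ℝ) ≠ 0 := by positivity
  simp only [Nat.choose_self, show a + 2 - 1 = a + 1 by omega]
  push_cast
  field_simp

/-- For fixed $j\ge1$ the sum over $v$ is an $(a+2)$-th difference of a polynomial of degree
$a+2-j$. -/
theorem sum_aCoeff {a M : ℕ} (x : ℝ) (hM : 2 * a + 4 < M) :
    ∑ i ∈ range M, aCoeff a i x = 0 := by
  simp only [aCoeff_eq_diagSum]
  rw [sum_range_diagSum (aTerm_of_left_lt x) (aTerm_of_right_lt x) (by omega)]
  refine sum_eq_zero fun j hj => ?_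
  rw [mem_range] at hj
  rcases Nat.eq_zero_or_pos j with h | h
  · simp [aTerm, h]
  · have h0 := factorial_mul_recipFact_sum (n := a + 2) (A := a + 2) (s := 0) (j := j)
      (by omega) (by omega)
    rw [← mul_zero (-((a + 1).choose (j - 1) : ℝ) * x ^ j / ((a + 2).factorial : ℝ)), ← h0, mul_sum]
    refine sum_congr rfl fun v _ => ?_
    rw [aTerm, if_neg (by omega), pow_succ]
    ring

/-! ### The coefficients `β_i` -/

/-- The summand of `β_{j+v}^{(1)}` with index `j`. -/
noncomputable def betaTerm1 (a : ℕ) (x : ℝ) (j v : ℕ) : ℝ :=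
  if j = 0 then 0 else
    1 / ((a : ℝ) + 1) * recipFact 2 (j + v) *
      ((-1) ^ (v + 1) * ((a + 2).choose (j - 1) : ℝ) * ((a + 3).choose v : ℝ) *
        (((a + 1 + v).factorial : ℝ) / ((a + 1).factorial : ℝ)) * x ^ (j - 1))

/-- The summand of `β_{j+v}^{(2)}` with index `j`. -/
noncomputable def betaTerm2 (a : ℕ) (x : ℝ) (j v : ℕ) : ℝ :=
  if j < 2 then 0 else
    2 * ((a : ℝ) + 2) / ((a : ℝ) + 1) * recipFact 1 (j + v) *
      ((-1) ^ (v + 1) * ((a + 1).choose (j - 2) : ℝ) * ((a + 2).choose v : ℝ) *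
        (((a + 2 + v).factorial : ℝ) / ((a + 2).factorial : ℝ)) * x ^ (j - 2))

/-- The summand of `β_{j+v}^{(3)}` with index `j`. -/
noncomputable def betaTerm3 (a : ℕ) (x : ℝ) (j v : ℕ) : ℝ :=
  1 / (((a : ℝ) + 1) ^ 2 * ((a : ℝ) + 2) * ((a : ℝ) + 3) ^ 2) * recipFact 2 (j + v) *
    ((-1) ^ (v + 1) * ((a + 3).choose j : ℝ) * ((a + 3).choose v : ℝ) *
      (((a + v).factorial : ℝ) / (a.factorial : ℝ)) *
      (((a : ℝ) + 1) * ((a : ℝ) + 3) + (j : ℝ) * v) * x ^ j)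

/-- The summand of `β_{j+v}^{(4)}` with index `j`. -/
noncomputable def betaTerm4 (a : ℕ) (x : ℝ) (j v : ℕ) : ℝ :=
  1 / (((a : ℝ) + 1) ^ 2 * ((a : ℝ) + 3) * ((a : ℝ) + 4) ^ 2) * recipFact 3 (j + v) *
    ((-1) ^ (v + 1) * ((a + 4).choose j : ℝ) * ((a + 4).choose v : ℝ) *
      (((a + v).factorial : ℝ) / (a.factorial : ℝ)) *
      (((a : ℝ) + 1) * ((a : ℝ) + 4) + (j : ℝ) * v) * x ^ j)

/-- The zero convention of `recipFact`, and the cutoff $j\ge2$ in `betaTerm2`, reproduce $\beta_i=0$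
for $i\le1$. -/
theorem betaCoeff_eq_diagSum (a i : ℕ) (x : ℝ) :
    betaCoeff a i x = diagSum (betaTerm1 a x) i + diagSum (betaTerm2 a x) i +
      diagSum (betaTerm3 a x) i + diagSum (betaTerm4 a x) i := by
  rcases Nat.lt_or_ge 1 i with hi | hi
  · have e1 : betaCoeff1 a i x = diagSum (betaTerm1 a x) i := by
      rw [betaCoeff1, mul_sum]
      refine sum_Icc_eq_diagSum_of_zero (fun j v hj h => ?_) fun j v hj => ?_
      · subst h
        rw [betaTerm1, if_neg (by omega), recipFact_eq hi, Nat.add_sub_cancel_left, binom_two,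
          binom_three, poch_two, neg_one_pow_diag, one_div_mul_one_div]
      · rw [betaTerm1, if_pos (by omega)]
    have e2 : betaCoeff2 a i x = diagSum (betaTerm2 a x) i := by
      rw [betaCoeff2, mul_sum]
      refine sum_Icc_eq_diagSum_of_zero (fun j v hj h => ?_) fun j v hj => ?_
      · subst h
        rw [betaTerm2, if_neg (by omega), recipFact_eq hi.le, Nat.add_sub_cancel_left, binom_one,
          binom_two, poch_three, neg_one_pow_diag, div_mul_div_comm, mul_one]
      · rw [betaTerm2, if_pos hj]
    have e3 : betaCoeff3 a i x = diagSum (betaTerm3 a x) i := by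
      rw [betaCoeff3, mul_sum]
      refine sum_Icc_eq_diagSum fun j v h => ?_
      subst h
      rw [betaTerm3, recipFact_eq hi, Nat.add_sub_cancel_left, binom_three,
        binom_three, poch_one, neg_one_pow_diag, one_div_mul_one_div]
      push_cast
      rw [add_sub_cancel_left]
    have e4 : betaCoeff4 a i x = diagSum (betaTerm4 a x) i := by
      rw [betaCoeff4, mul_sum]
      refine sum_Icc_eq_diagSum fun j v h => ?_
      subst h
      -- The factor $i-2$ turns $1/(i-2)!$ into $1/(i-3)!$, read as $0$ at $i=2$.
      rw [betaTerm4, recipFact_succ hi, recipFact_eq hi, Nat.add_sub_cancel_left, binom_four,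
        binom_four, poch_one, neg_one_pow_diag]
      push_cast
      rw [add_sub_cancel_left]
      field_simp
    rw [betaCoeff, if_neg (by omega), e1, e2, e3, e4]
  · have e : ∀ f : ℕ → ℕ → ℝ, (∀ j v, j + v ≤ 1 → f j v = 0) → diagSum f i = 0 := by
      intro f hf
      refine sum_eq_zero fun k hk => hf _ _ ?_
      rw [mem_range] at hk
      omega
    rw [betaCoeff, if_pos hi, e, e, e, e]
    · simp
    · intro j v h
      simp [betaTerm4, recipFact_of_lt (show j + v < 3 by omega)]
    · intro j v h
      simp [betaTerm3, recipFact_of_lt (show j + v < 2 by omega)]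
    · intro j v h
      rw [betaTerm2, if_pos (by omega)]
    · intro j v h
      simp [betaTerm1, recipFact_of_lt (show j + v < 2 by omega)]

theorem betaTerm1_of_left_lt {a : ℕ} (x : ℝ) (j v : ℕ) (h : a + 3 < j) :
    betaTerm1 a x j v = 0 := by
  simp [betaTerm1, Nat.choose_eq_zero_of_lt (show a + 2 < j - 1 by omega)]

theorem betaTerm1_of_right_lt {a : ℕ} (x : ℝ) (j v : ℕ) (h : a + 3 < v) :
    betaTerm1 a x j v = 0 := by
  simp [betaTerm1, Nat.choose_eq_zero_of_lt h]

theorem betaTerm2_of_left_lt {a : ℕ} (x : ℝ) (j v : ℕ) (h : a + 3 < j) :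
    betaTerm2 a x j v = 0 := by
  simp [betaTerm2, Nat.choose_eq_zero_of_lt (show a + 1 < j - 2 by omega)]

theorem betaTerm2_of_right_lt {a : ℕ} (x : ℝ) (j v : ℕ) (h : a + 2 < v) :
    betaTerm2 a x j v = 0 := by
  simp [betaTerm2, Nat.choose_eq_zero_of_lt h]

theorem betaTerm3_of_left_lt {a : ℕ} (x : ℝ) (j v : ℕ) (h : a + 3 < j) :
    betaTerm3 a x j v = 0 := by
  simp [betaTerm3, Nat.choose_eq_zero_of_lt h]

theorem betaTerm3_of_right_lt {a : ℕ} (x : ℝ) (j v : ℕ) (h : a + 3 < v) :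
    betaTerm3 a x j v = 0 := by
  simp [betaTerm3, Nat.choose_eq_zero_of_lt h]

theorem betaTerm4_of_left_lt {a : ℕ} (x : ℝ) (j v : ℕ) (h : a + 4 < j) :
    betaTerm4 a x j v = 0 := by
  simp [betaTerm4, Nat.choose_eq_zero_of_lt h]

theorem betaTerm4_of_right_lt {a : ℕ} (x : ℝ) (j v : ℕ) (h : a + 4 < v) :
    betaTerm4 a x j v = 0 := by
  simp [betaTerm4, Nat.choose_eq_zero_of_lt h]

/-- The boxes of the first three parts have corners on diagonals up to $2a+6$; only the fourth
reaches $2a+8$. -/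
theorem betaCoeff_eq_diagSum4 {a i : ℕ} (x : ℝ) (h : 2 * a + 6 < i) :
    betaCoeff a i x = diagSum (betaTerm4 a x) i := by
  rw [betaCoeff_eq_diagSum,
    diagSum_eq_zero (betaTerm1_of_left_lt x) (betaTerm1_of_right_lt x) (by omega),
    diagSum_eq_zero (betaTerm2_of_left_lt x) (betaTerm2_of_right_lt x) (by omega),
    diagSum_eq_zero (betaTerm3_of_left_lt x) (betaTerm3_of_right_lt x) (by omega)]
  simp

theorem betaCoeff_zero (a : ℕ) (x : ℝ) : betaCoeff a 0 x = 0 := by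
  simp [betaCoeff]

theorem betaCoeff_eq_zero {a i : ℕ} (x : ℝ) (h : 2 * a + 8 < i) : betaCoeff a i x = 0 := by
  rw [betaCoeff_eq_diagSum4 x (by omega)]
  exact diagSum_eq_zero (betaTerm4_of_left_lt x) (betaTerm4_of_right_lt x) (by omega)

theorem betaCoeff_top (a : ℕ) (x : ℝ) :
    betaCoeff a (2 * a + 8) x = (-1) ^ (a + 5) /
      (((a : ℝ) + 1) ^ 2 * ((a : ℝ) + 3) * ((a : ℝ) + 4) * (a.factorial : ℝ)) * x ^ (a + 4) := by
  rw [betaCoeff_eq_diagSum4 x (by omega), show 2 * a + 8 = (a + 4) + (a + 4) by ring,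
    diagSum_add_eq (betaTerm4_of_left_lt x) (betaTerm4_of_right_lt x), betaTerm4,
    show a + 4 + (a + 4) = 3 + (a + (a + 4) + 1) by ring, recipFact_add, Nat.factorial_succ]
  have h : ((a + (a + 4)).factorial : ℝ) ≠ 0 := by positivity
  have h1 : ((a : ℝ) + (a + 4) + 1) ≠ 0 := by positivity
  simp only [Nat.choose_self]
  push_cast
  field_simp
  ring

theorem sum_betaCoeff {a M : ℕ} (x : ℝ) (hM : 2 * a + 8 < M) :
    ∑ i ∈ range M, betaCoeff a i x = 0 := by
  simp only [betaCoeff_eq_diagSum, sum_add_distrib]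
  have e1 : ∑ i ∈ range M, diagSum (betaTerm1 a x) i = 0 := by
    rw [sum_range_diagSum (betaTerm1_of_left_lt x) (betaTerm1_of_right_lt x) (by omega)]
    refine sum_eq_zero fun j hj => ?_
    rw [mem_range] at hj
    rcases Nat.eq_zero_or_pos j with h | h
    · simp [betaTerm1, h]
    · have h0 := factorial_mul_recipFact_sum (n := a + 3) (A := a + 1) (s := 2) (j := j)
        (by omega) (by omega)
      rw [← mul_zero (-((a + 2).choose (j - 1) : ℝ) * x ^ (j - 1) / ((a + 1).factorial : ℝ) *
        (1 / ((a : ℝ) + 1))), ← h0, mul_sum]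
      refine sum_congr rfl fun v _ => ?_
      rw [betaTerm1, if_neg (by omega), pow_succ]
      ring
  have e2 : ∑ i ∈ range M, diagSum (betaTerm2 a x) i = 0 := by
    rw [sum_range_diagSum (betaTerm2_of_left_lt x) (betaTerm2_of_right_lt x) (by omega)]
    refine sum_eq_zero fun j hj => ?_
    rw [mem_range] at hj
    rcases Nat.lt_or_ge j 2 with h | h
    · simp [betaTerm2, h]
    · have h0 := factorial_mul_recipFact_sum (n := a + 2) (A := a + 2) (s := 1) (j := j)
        (by omega) (by omega)
      rw [← mul_zero (-((a + 1).choose (j - 2) : ℝ) * x ^ (j - 2) / ((a + 2).factorial : ℝ) *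
        (2 * ((a : ℝ) + 2) / ((a : ℝ) + 1))), ← h0, mul_sum]
      refine sum_congr rfl fun v _ => ?_
      rw [betaTerm2, if_neg (by omega), pow_succ]
      ring
  have e3 : ∑ i ∈ range M, diagSum (betaTerm3 a x) i = 0 := by
    rw [sum_range_diagSum (betaTerm3_of_left_lt x) (betaTerm3_of_right_lt x) (by omega)]
    refine sum_eq_zero fun j hj => ?_
    rw [mem_range] at hj
    have h0 := factorial_mul_recipFact_linear_sum (n := a + 3) (a := a) (s := 2) (j := j)
      rfl (by omega)
    rw [← mul_zero (-((a + 3).choose j : ℝ) * x ^ j / (a.factorial : ℝ) *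
      (1 / (((a : ℝ) + 1) ^ 2 * ((a : ℝ) + 2) * ((a : ℝ) + 3) ^ 2))), ← h0, mul_sum]
    refine sum_congr rfl fun v _ => ?_
    rw [betaTerm3, pow_succ (-1 : ℝ) v]
    push_cast
    ring
  have e4 : ∑ i ∈ range M, diagSum (betaTerm4 a x) i = 0 := by
    rw [sum_range_diagSum (betaTerm4_of_left_lt x) (betaTerm4_of_right_lt x) (by omega)]
    refine sum_eq_zero fun j hj => ?_
    rw [mem_range] at hj
    have h0 := factorial_mul_recipFact_linear_sum (n := a + 4) (a := a) (s := 3) (j := j)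
      rfl (by omega)
    rw [← mul_zero (-((a + 4).choose j : ℝ) * x ^ j / (a.factorial : ℝ) *
      (1 / (((a : ℝ) + 1) ^ 2 * ((a : ℝ) + 3) * ((a : ℝ) + 4) ^ 2))), ← h0, mul_sum]
    refine sum_congr rfl fun v _ => ?_
    rw [betaTerm4, pow_succ (-1 : ℝ) v]
    push_cast
    ring
  rw [e1, e2, e3, e4]
  simp

/-! ### Convolutions with a coefficient sequence -/

/-- The double diagonal sum of `c k * g k u v` over `k + u + v = i`. -/
noncomputable def convSum (c : ℕ → ℝ) (g : ℕ → ℕ → ℕ → ℝ) (i : ℕ) : ℝ :=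
  diagSum (fun k w => c k * diagSum (g k) w) i

section convSum

variable {c : ℕ → ℝ} {g : ℕ → ℕ → ℕ → ℝ} {A U V : ℕ}

theorem convSum_eq_zero (hc : ∀ k, A < k → c k = 0) (hU : ∀ k u v, U < u → g k u v = 0)
    (hV : ∀ k u v, V < v → g k u v = 0) {i : ℕ} (hi : A + (U + V) < i) : convSum c g i = 0 := by
  refine diagSum_eq_zero (A := A) (B := U + V) (fun k w h => ?_) (fun k w h => ?_) hi
  · rw [hc k h, zero_mul]
  · rw [diagSum_eq_zero (hU k) (hV k) h, mul_zero]

theorem convSum_add_eq (hc : ∀ k, A < k → c k = 0) (hU : ∀ k u v, U < u → g k u v = 0)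
    (hV : ∀ k u v, V < v → g k u v = 0) : convSum c g (A + (U + V)) = c A * g A U V := by
  rw [convSum, diagSum_add_eq (A := A) (B := U + V) (fun k w h => ?_) (fun k w h => ?_),
    diagSum_add_eq (hU A) (hV A)]
  · rw [hc k h, zero_mul]
  · rw [diagSum_eq_zero (hU k) (hV k) h, mul_zero]

/-- The total factorises because the mass `C` of the kernel does not depend on `k`. -/
theorem sum_range_convSum (hc : ∀ k, A < k → c k = 0) (hU : ∀ k u v, U < u → g k u v = 0)
    (hV : ∀ k u v, V < v → g k u v = 0) {C : ℝ}
    (hC : ∀ k, ∑ u ∈ range (U + 1), ∑ v ∈ range (V + 1), g k u v = C) {M : ℕ}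
    (hM : A + (U + V) < M) :
    ∑ i ∈ range M, convSum c g i = (∑ k ∈ range (A + 1), c k) * C := by
  unfold convSum
  rw [sum_range_diagSum (A := A) (B := U + V) (fun k w h => ?_) (fun k w h => ?_) hM, sum_mul]
  · refine sum_congr rfl fun k _ => ?_
    rw [← mul_sum, sum_range_diagSum (hU k) (hV k) (Nat.lt_succ_self _), hC]
  · rw [hc k h, zero_mul]
  · rw [diagSum_eq_zero (hU k) (hV k) h, mul_zero]

end convSum

/-- For given `u` the polynomial in `v` has degree $n-u$, so only $u=0$ survives and `x` drops out.
-/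
theorem sum_alternating_fall {n A s k : ℕ} (h : A + s = k + n) (x : ℝ) :
    ∑ u ∈ range (n + 1), ∑ v ∈ range (n + 1), (n.choose u : ℝ) * x ^ u *
      ((-1) ^ v * (n.choose v : ℝ) * (((A + v).factorial : ℝ) * recipFact s (k + u + v))) =
      (-1) ^ n * (n.factorial : ℝ) := by
  rw [sum_range_succ', sum_eq_zero, zero_add, ← mul_sum]
  · simp only [add_zero, Nat.choose_zero_right, Nat.cast_one, pow_zero, one_mul]
    exact factorial_mul_recipFact_sum_self h
  · intro u hu
    rw [mem_range] at hu
    rw [← mul_sum, factorial_mul_recipFact_sum (by omega) (by omega), mul_zero]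

/-! ### The coefficients `γ_i^{(1)}` -/

/-- The kernel of the convolution giving `γ_i^{(1)}`. -/
noncomputable def gammaKernel1 (a : ℕ) (x : ℝ) (k u v : ℕ) : ℝ :=
  -(1 / (((a : ℝ) + 1) * ((a + 3).factorial : ℝ))) *
    (((a + 3).choose u : ℝ) * x ^ u * ((-1) ^ v * ((a + 3).choose v : ℝ) *
      (((a + 2 + k + v).factorial : ℝ) * recipFact 1 (k + u + v))))

theorem gammaCoeff1_eq_convSum (a i : ℕ) (x : ℝ) :
    gammaCoeff1 a i x = convSum (fun k => aCoeff a k x) (gammaKernel1 a x) i := by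
  rw [gammaCoeff1, mul_sum, convSum]
  refine sum_Icc_eq_diagSum_of_zero (fun k w hk h => ?_) fun k w hk => ?_
  · subst h
    rw [mul_left_comm, mul_sum]
    congr 1
    refine sum_Icc_shift_eq_diagSum fun u v h => ?_
    subst h
    -- With $k\ge1$ made explicit, the truncated subtractions in $(i-1)!$ and in the Pochhammer
    -- index are exact.
    obtain ⟨k, rfl⟩ := Nat.exists_eq_add_of_le' hk
    rw [gammaKernel1, Nat.add_sub_cancel_left, ← add_assoc, Nat.add_sub_cancel_left, binom_three,
      binom_three, poch_four, recipFact_eq (by omega)]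
    rw [show a + 3 + (v + (k + 1) - 1) = a + 2 + (k + 1) + v by omega]
    have hs : (-1 : ℝ) ^ (k + 1 + u + v + 1) * (-1) ^ (k + 1 + u) = -(-1) ^ v := by
      rw [← pow_add, show k + 1 + u + v + 1 + (k + 1 + u) = (k + 1 + u) + (k + 1 + u) + (v + 1) by
        ring, neg_one_pow_add_self, pow_succ]
      ring
    have h1 : ((a + 3).factorial : ℝ) ≠ 0 := by positivity
    have h2 : ((k + 1 + u + v - 1).factorial : ℝ) ≠ 0 := by positivity
    have h3 : (a : ℝ) + 1 ≠ 0 := by positivity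
    field_simp
    linear_combination ((a + 3).choose u : ℝ) * ((a + 3).choose v : ℝ) * x ^ u * hs
  · obtain rfl : k = 0 := by omega
    simp [aCoeff_zero]

theorem gammaKernel1_of_left_lt {a : ℕ} (x : ℝ) (k u v : ℕ) (h : a + 3 < u) :
    gammaKernel1 a x k u v = 0 := by
  simp [gammaKernel1, Nat.choose_eq_zero_of_lt h]

theorem gammaKernel1_of_right_lt {a : ℕ} (x : ℝ) (k u v : ℕ) (h : a + 3 < v) :
    gammaKernel1 a x k u v = 0 := by
  simp [gammaKernel1, Nat.choose_eq_zero_of_lt h]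

theorem gammaCoeff1_eq_zero {a i : ℕ} (x : ℝ) (h : 4 * a + 10 < i) : gammaCoeff1 a i x = 0 := by
  rw [gammaCoeff1_eq_convSum]
  exact convSum_eq_zero (fun k => aCoeff_eq_zero x) (gammaKernel1_of_left_lt x)
    (gammaKernel1_of_right_lt x) (by omega)

theorem gammaCoeff1_top (a : ℕ) (x : ℝ) :
    gammaCoeff1 a (4 * a + 10) x =
      -(x ^ (2 * a + 5) / (((a : ℝ) + 1) * ((a + 2).factorial : ℝ) * ((a + 3).factorial : ℝ))) := by
  rw [gammaCoeff1_eq_convSum,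
    show 4 * a + 10 = (2 * a + 4) + ((a + 3) + (a + 3)) by ring,
    convSum_add_eq (fun k => aCoeff_eq_zero x) (gammaKernel1_of_left_lt x)
      (gammaKernel1_of_right_lt x), aCoeff_top, gammaKernel1,
    show 2 * a + 4 + (a + 3) + (a + 3) = 1 + (4 * a + 9) by ring, recipFact_add,
    show a + 2 + (2 * a + 4) + (a + 3) = 4 * a + 9 by ring]
  have hs : (-1 : ℝ) ^ (a + 3) * (-1) ^ (a + 3) = 1 := by rw [← mul_pow]; simp
  have h1 : ((a + 3).factorial : ℝ) ≠ 0 := by positivity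
  have h2 : ((a + 2).factorial : ℝ) ≠ 0 := by positivity
  have h4 : ((4 * a + 9).factorial : ℝ) ≠ 0 := by positivity
  have h3 : (a : ℝ) + 1 ≠ 0 := by positivity
  simp only [Nat.choose_self, Nat.cast_one]
  rw [show 2 * a + 5 = (a + 2) + (a + 3) by ring, pow_add x]
  field_simp
  linear_combination -x ^ (a + 2) * x ^ (a + 3) * hs

theorem sum_gammaCoeff1 {a M : ℕ} (x : ℝ) (hM : 4 * a + 10 < M) :
    ∑ i ∈ range M, gammaCoeff1 a i x = 0 := by
  simp only [gammaCoeff1_eq_convSum]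
  rw [sum_range_convSum (fun k => aCoeff_eq_zero x) (gammaKernel1_of_left_lt x)
    (gammaKernel1_of_right_lt x) (C := -(1 / (((a : ℝ) + 1) * ((a + 3).factorial : ℝ))) *
      ((-1) ^ (a + 3) * ((a + 3).factorial : ℝ))) (fun k => ?_) (by omega),
    sum_aCoeff x (by omega), zero_mul]
  simp only [gammaKernel1, ← mul_sum]
  rw [← sum_alternating_fall (n := a + 3) (A := a + 2 + k) (s := 1) (k := k) (by omega) x]
  simp only [← mul_sum]

/-! ### The coefficients `γ_i^{(2)}` -/

/-- The kernel of the convolution giving `γ_i^{(2)}`. -/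
noncomputable def gammaKernel2 (a : ℕ) (x : ℝ) (k u v : ℕ) : ℝ :=
  1 / ((a + 2).factorial : ℝ) *
    (((a + 1).choose u : ℝ) * x ^ u * ((-1) ^ v * ((a + 1).choose v : ℝ) *
      (((a + 2 + k + v).factorial : ℝ) * recipFact 0 (k + 1 + u + v))))

theorem gammaCoeff2_eq_convSum (a i : ℕ) (x : ℝ) :
    gammaCoeff2 a i x = convSum (fun k => betaCoeff a k x) (gammaKernel2 a x) i := by
  rw [gammaCoeff2, mul_sum, convSum]
  refine sum_Icc_eq_diagSum_of_zero (fun k w hk h => ?_) fun k w hk => ?_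
  · subst h
    rw [mul_left_comm, mul_sum]
    congr 1
    refine sum_Icc_shift_eq_diagSum fun u v h => ?_
    subst h
    rw [gammaKernel2, Nat.add_sub_cancel_left, ← add_assoc, Nat.add_sub_cancel_left, binom_one,
      binom_one, poch_three, recipFact_zero, show k + u + v + 1 = k + 1 + u + v by ring,
      show a + 2 + (v + k) = a + 2 + k + v by ring]
    have hs : (-1 : ℝ) ^ (k + u + v) * (-1) ^ (k + u) = (-1) ^ v := by
      rw [← pow_add, show k + u + v + (k + u) = (k + u) + (k + u) + v by ring,
        neg_one_pow_add_self]
    have h1 : ((a + 2).factorial : ℝ) ≠ 0 := by positivity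
    have h2 : ((k + 1 + u + v).factorial : ℝ) ≠ 0 := by positivity
    field_simp
    linear_combination ((a + 1).choose u : ℝ) * ((a + 1).choose v : ℝ) * x ^ u * hs
  · obtain rfl : k = 0 := by omega
    simp [betaCoeff_zero]

theorem gammaKernel2_of_left_lt {a : ℕ} (x : ℝ) (k u v : ℕ) (h : a + 1 < u) :
    gammaKernel2 a x k u v = 0 := by
  simp [gammaKernel2, Nat.choose_eq_zero_of_lt h]

theorem gammaKernel2_of_right_lt {a : ℕ} (x : ℝ) (k u v : ℕ) (h : a + 1 < v) :
    gammaKernel2 a x k u v = 0 := by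
  simp [gammaKernel2, Nat.choose_eq_zero_of_lt h]

theorem gammaCoeff2_eq_zero {a i : ℕ} (x : ℝ) (h : 4 * a + 10 < i) : gammaCoeff2 a i x = 0 := by
  rw [gammaCoeff2_eq_convSum]
  exact convSum_eq_zero (fun k => betaCoeff_eq_zero x) (gammaKernel2_of_left_lt x)
    (gammaKernel2_of_right_lt x) (by omega)

theorem gammaCoeff2_top (a : ℕ) (x : ℝ) :
    gammaCoeff2 a (4 * a + 10) x =
      x ^ (2 * a + 5) * ((a : ℝ) + 2) /
        (((a : ℝ) + 1) * ((a : ℝ) + 4) * ((a + 2).factorial : ℝ) * ((a + 3).factorial : ℝ)) := by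
  rw [gammaCoeff2_eq_convSum,
    show 4 * a + 10 = (2 * a + 8) + ((a + 1) + (a + 1)) by ring,
    convSum_add_eq (fun k => betaCoeff_eq_zero x) (gammaKernel2_of_left_lt x)
      (gammaKernel2_of_right_lt x), betaCoeff_top, gammaKernel2, recipFact_zero,
    show 2 * a + 8 + 1 + (a + 1) + (a + 1) = 4 * a + 11 by ring,
    show a + 2 + (2 * a + 8) + (a + 1) = 4 * a + 11 by ring]
  have hs : (-1 : ℝ) ^ (a + 1) * (-1) ^ (a + 1) = 1 := by rw [← mul_pow]; simp
  have h4 : ((4 * a + 11).factorial : ℝ) ≠ 0 := by positivity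
  simp only [Nat.choose_self, Nat.cast_one]
  rw [show 2 * a + 5 = (a + 4) + (a + 1) by ring, pow_add x,
    show a + 5 = (a + 1) + 4 by ring, pow_add (-1 : ℝ), Nat.factorial_succ (a + 2),
    Nat.factorial_succ (a + 1), Nat.factorial_succ a]
  have h1 : (a.factorial : ℝ) ≠ 0 := by positivity
  push_cast
  have e1 : (a : ℝ) + 1 + 1 = a + 2 := by ring
  have e2 : (a : ℝ) + 2 + 1 = a + 3 := by ring
  rw [e1, e2]
  have h2 : (a : ℝ) + 1 ≠ 0 := by positivity
  have h3 : (a : ℝ) + 2 ≠ 0 := by positivity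
  have h5 : (a : ℝ) + 3 ≠ 0 := by positivity
  have h6 : (a : ℝ) + 4 ≠ 0 := by positivity
  field_simp
  linear_combination x ^ (a + 4) * x ^ (a + 1) * hs

theorem sum_gammaCoeff2 {a M : ℕ} (x : ℝ) (hM : 4 * a + 10 < M) :
    ∑ i ∈ range M, gammaCoeff2 a i x = 0 := by
  simp only [gammaCoeff2_eq_convSum]
  rw [sum_range_convSum (fun k => betaCoeff_eq_zero x) (gammaKernel2_of_left_lt x)
    (gammaKernel2_of_right_lt x) (C := 1 / ((a + 2).factorial : ℝ) *
      ((-1) ^ (a + 1) * ((a + 1).factorial : ℝ))) (fun k => ?_) (by omega),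
    sum_betaCoeff x (by omega), zero_mul]
  simp only [gammaKernel2, ← mul_sum]
  rw [← sum_alternating_fall (n := a + 1) (A := a + 2 + k) (s := 0) (k := k + 1) (by omega) x]
  simp only [← mul_sum]

/-! ### The coefficients `γ_i^{(5)}` -/

/-- The summand of `γ_{j+v}^{(5)}` with indices `k` and `j`, up to a factor depending on `k`. -/
noncomputable def gammaTerm5 (a : ℕ) (x : ℝ) (k j v : ℕ) : ℝ :=
  ((k + a + 3).choose j : ℝ) * x ^ j * ((-1) ^ v * ((k + a + 3).choose v : ℝ) *
    (((a + 2 + v).factorial : ℝ) * recipFact (k + 1) (j + v)))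

/-- The factor by which `gammaTerm5` enters `γ_i^{(5)}`. -/
noncomputable def gammaFactor5 (a k : ℕ) : ℝ :=
  -(((a + 2).choose k : ℝ) /
    (((a : ℝ) + 1) * ((a : ℝ) + 3 + k) * ((k + 1).factorial : ℝ) * ((a + 2).factorial : ℝ)))

theorem poch_succ_left (c : ℝ) (k : ℕ) : poch c (k + 1) = c * poch (c + 1) k := by
  simp [poch, ascPochhammer_succ_left, eval_comp]

theorem poch_succ_right (c : ℝ) (k : ℕ) : poch c (k + 1) = poch c k * (c + k) := by
  simp [poch, ascPochhammer_succ_eval]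

theorem gammaCoeff5_eq (a i : ℕ) (x : ℝ) :
    gammaCoeff5 a i x =
      ∑ k ∈ range (a + 3), gammaFactor5 a k * diagSum (gammaTerm5 a x k) i := by
  have hT : ∀ k : ℕ, (-1 : ℝ) ^ (i + 1) / (((a : ℝ) + 1) * (a + 3)) * ((-1) ^ k *
      (poch (-a - 2) k * poch (a + 3) k) / (poch 2 k * poch (a + 4) k * (k.factorial : ℝ)) *
      invGamma ((i : ℝ) - (k : ℝ)) * ∑ j ∈ Icc 0 i, (-1) ^ j * binom ((k : ℝ) + a + 3) j *
        binom ((k : ℝ) + a + 3) (i - j) * poch (a + 3) (i - j) * x ^ j) =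
      gammaFactor5 a k * diagSum (gammaTerm5 a x k) i := by
    intro k
    have e1 : poch (-(a : ℝ) - 2) k = (-1) ^ k * (k.factorial : ℝ) * ((a + 2).choose k : ℝ) := by
      rw [← poch_neg_natCast]
      congr 1
      push_cast
      ring
    have e2 : poch 2 k = ((k + 1).factorial : ℝ) := by
      have := poch_natCast_add_one 1 k
      rw [Nat.factorial_one, Nat.cast_one, div_one, add_comm 1 k] at this
      rw [← this]
      norm_num
    -- The quotient $(a+3)_k/(a+4)_k$ telescopes to $(a+3)/(a+3+k)$.
    have e3 : poch ((a : ℝ) + 3) k * (a + 3 + k) = (a + 3) * poch ((a : ℝ) + 4) k := by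
      rw [← poch_succ_right, poch_succ_left]
      ring_nf
    have e4 : poch ((a : ℝ) + 4) k ≠ 0 := by
      rw [poch_four]
      positivity
    have e5 : ∀ j, binom ((k : ℝ) + a + 3) j = ((k + a + 3).choose j : ℝ) := by
      intro j
      rw [← binom_natCast]
      norm_cast
    have hk : (-1 : ℝ) ^ k * (-1) ^ k = 1 := by rw [← mul_pow]; simp
    have hfac : (-1 : ℝ) ^ k * (poch (-a - 2) k * poch (a + 3) k) /
        (poch 2 k * poch (a + 4) k * (k.factorial : ℝ)) =
        ((a + 2).choose k : ℝ) * (a + 3) / ((a + 3 + k) * ((k + 1).factorial : ℝ)) := by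
      rw [e1, e2]
      have h1 : (k.factorial : ℝ) ≠ 0 := by positivity
      have h2 : ((k + 1).factorial : ℝ) ≠ 0 := by positivity
      have h3 : (a : ℝ) + 3 + k ≠ 0 := by positivity
      rw [div_eq_div_iff (by positivity) (by positivity)]
      linear_combination ((a + 2).choose k : ℝ) * poch (a + 3) k * (k.factorial : ℝ) *
        ((a + 3 + k) * ((k + 1).factorial : ℝ)) * hk + ((a + 2).choose k : ℝ) *
        (k.factorial : ℝ) * ((k + 1).factorial : ℝ) * e3
    have hsum : (-1 : ℝ) ^ (i + 1) * (invGamma ((i : ℝ) - k) * ∑ j ∈ Icc 0 i, (-1) ^ j *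
        binom ((k : ℝ) + a + 3) j * binom ((k : ℝ) + a + 3) (i - j) * poch (a + 3) (i - j) *
        x ^ j) = -(1 / ((a + 2).factorial : ℝ)) * diagSum (gammaTerm5 a x k) i := by
      have : diagSum (gammaTerm5 a x k) i = ∑ j ∈ Icc 0 i, gammaTerm5 a x k j (i - j) := by
        symm
        refine sum_Icc_eq_diagSum fun j v h => ?_
        rw [← h, Nat.add_sub_cancel_left]
      rw [this, mul_sum, mul_sum, mul_sum]
      refine sum_congr rfl fun j hj => ?_
      obtain ⟨v, rfl⟩ := Nat.exists_eq_add_of_le (mem_Icc.1 hj).2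
      rw [Nat.add_sub_cancel_left, invGamma_sub, e5, e5, poch_three, gammaTerm5]
      have hs : (-1 : ℝ) ^ (j + v + 1) * (-1) ^ j = -(-1) ^ v := by
        rw [← pow_add, show j + v + 1 + j = j + j + (v + 1) by ring, neg_one_pow_add_self,
          pow_succ]
        ring
      linear_combination recipFact (k + 1) (j + v) * ((k + a + 3).choose j : ℝ) *
        ((k + a + 3).choose v : ℝ) * (((a + 2 + v).factorial : ℝ) / ((a + 2).factorial : ℝ)) *
        x ^ j * hs
    rw [hfac, div_mul_eq_mul_div, mul_assoc, mul_left_comm, hsum, gammaFactor5]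
    have h1 : (a : ℝ) + 1 ≠ 0 := by positivity
    have h2 : (a : ℝ) + 3 ≠ 0 := by positivity
    have h3 : (a : ℝ) + 3 + k ≠ 0 := by positivity
    field_simp
  rw [gammaCoeff5, mul_sum, sum_congr rfl fun k _ => hT k]
  -- The range $k<i$ can be replaced by $k<a+3$: terms with $k\ge a+3$ vanish by $\binom{a+2}{k}=0$,
  -- those with $k\ge i$ by $1/\Gamma(i-k)=0$.
  have h1 : ∀ k, a + 3 ≤ k → gammaFactor5 a k * diagSum (gammaTerm5 a x k) i = 0 := by
    intro k hk
    simp [gammaFactor5, Nat.choose_eq_zero_of_lt (show a + 2 < k by omega)]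
  have h2 : ∀ k, i ≤ k → gammaFactor5 a k * diagSum (gammaTerm5 a x k) i = 0 := by
    intro k hk
    rw [diagSum, sum_eq_zero, mul_zero]
    intro j hj
    rw [mem_range] at hj
    rw [gammaTerm5, recipFact_of_lt (by omega)]
    simp
  rcases le_total i (a + 3) with h | h
  · exact sum_subset (range_subset_range.2 h) fun k _ hk => h2 k (by simpa using hk)
  · exact (sum_subset (range_subset_range.2 h) fun k _ hk => h1 k (by simpa using hk)).symm

theorem gammaTerm5_of_left_lt {a k : ℕ} (x : ℝ) (j v : ℕ) (h : k + a + 3 < j) :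
    gammaTerm5 a x k j v = 0 := by
  simp [gammaTerm5, Nat.choose_eq_zero_of_lt h]

theorem gammaTerm5_of_right_lt {a k : ℕ} (x : ℝ) (j v : ℕ) (h : k + a + 3 < v) :
    gammaTerm5 a x k j v = 0 := by
  simp [gammaTerm5, Nat.choose_eq_zero_of_lt h]

theorem gammaCoeff5_eq_zero {a i : ℕ} (x : ℝ) (h : 4 * a + 10 < i) : gammaCoeff5 a i x = 0 := by
  rw [gammaCoeff5_eq]
  refine sum_eq_zero fun k hk => ?_
  rw [mem_range] at hk
  rw [diagSum_eq_zero (gammaTerm5_of_left_lt x) (gammaTerm5_of_right_lt x) (by omega), mul_zero]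

theorem gammaCoeff5_top (a : ℕ) (x : ℝ) :
    gammaCoeff5 a (4 * a + 10) x = x ^ (2 * a + 5) /
      (((a : ℝ) + 1) * (2 * (a : ℝ) + 5) * ((a + 2).factorial : ℝ) * ((a + 3).factorial : ℝ)) := by
  -- The box for `k` ends on the diagonal $2(k+a+3)$, so only $k=a+2$ reaches $4a+10$.
  rw [gammaCoeff5_eq, sum_range_succ, sum_eq_zero, zero_add,
    show 4 * a + 10 = (a + 2 + a + 3) + (a + 2 + a + 3) by ring,
    diagSum_add_eq (gammaTerm5_of_left_lt x) (gammaTerm5_of_right_lt x), gammaTerm5, gammaFactor5,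
    show a + 2 + a + 3 + (a + 2 + a + 3) = (a + 2 + 1) + (a + 2 + (a + 2 + a + 3)) by ring,
    recipFact_add, show a + 2 + a + 3 = 2 * a + 5 by ring]
  · have hs : (-1 : ℝ) ^ (2 * a + 5) = -1 := Odd.neg_one_pow ⟨a + 2, by ring⟩
    have h1 : ((a + 2 + (2 * a + 5)).factorial : ℝ) ≠ 0 := by positivity
    simp only [Nat.choose_self, Nat.cast_one]
    rw [hs]
    push_cast
    rw [show (a : ℝ) + 3 + (a + 2) = 2 * a + 5 by ring]
    have h2 : ((a + 2).factorial : ℝ) ≠ 0 := by positivity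
    have h3 : ((a + 2 + 1).factorial : ℝ) ≠ 0 := by positivity
    have h4 : (a : ℝ) + 1 ≠ 0 := by positivity
    have h5 : 2 * (a : ℝ) + 5 ≠ 0 := by positivity
    field_simp
  · intro k hk
    rw [mem_range] at hk
    rw [diagSum_eq_zero (gammaTerm5_of_left_lt x) (gammaTerm5_of_right_lt x) (by omega), mul_zero]

theorem sum_gammaCoeff5 {a M : ℕ} (x : ℝ) (hM : 4 * a + 10 < M) :
    ∑ i ∈ range M, gammaCoeff5 a i x = 0 := by
  simp only [gammaCoeff5_eq]
  rw [sum_comm]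
  have h : ∀ k ∈ range (a + 3),
      ∑ i ∈ range M, gammaFactor5 a k * diagSum (gammaTerm5 a x k) i =
      (-1) ^ a / (((a : ℝ) + 1) * ((a + 2).factorial : ℝ)) *
        ((-1) ^ k * ((a + 2).choose k : ℝ) * ((k + (a + 2)).descFactorial (a + 1) : ℝ)) := by
    intro k hk
    rw [mem_range] at hk
    have h0 := sum_alternating_fall (n := k + a + 3) (A := a + 2) (s := k + 1) (k := 0)
      (by omega) x
    simp only [zero_add] at h0
    rw [← mul_sum, sum_range_diagSum (gammaTerm5_of_left_lt x) (gammaTerm5_of_right_lt x)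
      (by omega)]
    simp only [gammaTerm5]
    -- The box sum $\pm(k+a+3)!$ cancels the denominator $a+3+k$. What remains, $(k+a+2)!/(k+1)!$,
    -- has degree $a+1$ in `k`, below the order $a+2$ of the alternating sum.
    rw [h0, ← factorial_mul_recipFact (b := k + 1) (s := 0) (by omega), recipFact_zero,
      gammaFactor5, Nat.factorial_succ (k + a + 2), show k + (a + 2) = k + a + 2 by ring,
      show k + a + 3 = a + k + 3 by ring, pow_add, pow_add]
    have h3 : (a : ℝ) + 3 + k ≠ 0 := by positivity
    push_cast
    field_simp
    ring
  rw [sum_congr rfl h, ← mul_sum, sum_alternating_choose_descFactorial_of_lt _ (by omega),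
    mul_zero]

/-! ### The coefficients `γ_i^{(3)}` and `γ_i^{(4)}` -/

/-- The polynomial in `m` equal to `(m + a + 2)! (m + a + 3)! / (Γ(m) Γ(m + 2))`. -/
noncomputable def ratioPoly (a : ℕ) : ℝ[X] := fallPoly (a + 2) (a + 3) * fallPoly (a + 3) (a + 2)

theorem monic_ratioPoly (a : ℕ) : (ratioPoly a).Monic :=
  (monic_fallPoly _ _).mul (monic_fallPoly _ _)

theorem natDegree_ratioPoly (a : ℕ) : (ratioPoly a).natDegree = 2 * a + 5 := by
  rw [ratioPoly, (monic_fallPoly _ _).natDegree_mul (monic_fallPoly _ _), natDegree_fallPoly,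
    natDegree_fallPoly]
  ring

theorem degree_ratioPoly_lt (a : ℕ) : (ratioPoly a).degree < (2 * a + 6 : ℕ) := by
  rw [degree_eq_natDegree (monic_ratioPoly a).ne_zero, natDegree_ratioPoly]
  exact_mod_cast Nat.lt_succ_self _

theorem ratioPoly_eval (a m : ℕ) : (ratioPoly a).eval (m : ℝ) =
    ((m + a + 2).descFactorial (a + 3) : ℝ) * ((m + a + 3).descFactorial (a + 2) : ℝ) := by
  rw [ratioPoly, eval_mul, fallPoly_eval, fallPoly_eval]
  rfl

theorem ratioPoly_eval_neg (a : ℕ) : (ratioPoly a).eval (-(a : ℝ) - 3) = 0 := by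
  rw [ratioPoly, eval_mul, fallPoly, fallPoly, taylor_eval, taylor_eval]
  push_cast
  rw [show -(a : ℝ) - 3 + (a + 3) = 0 by ring, descPochhammer_ne_zero_eval_zero ℝ (by omega),
    mul_zero]

theorem natDegree_negDiff_iterate_ratioPoly_le {a N : ℕ} (h : N ≤ 2 * a + 5) :
    (negDiff^[N] (ratioPoly a)).natDegree ≤ 2 * a + 5 - N := by
  have h1 : (ratioPoly a).degree < ((2 * a + 5 - N + 1) + N : ℕ) := by
    rw [show 2 * a + 5 - N + 1 + N = 2 * a + 6 by omega]
    exact degree_ratioPoly_lt a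
  exact natDegree_le_iff_coeff_eq_zero.2 fun m hm =>
    (degree_lt_iff_coeff_zero _ _).1 (degree_negDiff_iterate_lt h1) m hm

theorem negDiff_iterate_ratioPoly_eq_zero {a N : ℕ} (h : 2 * a + 5 < N) :
    negDiff^[N] (ratioPoly a) = 0 := by
  have h1 : (ratioPoly a).degree < (0 + N : ℕ) :=
    (degree_ratioPoly_lt a).trans_le (by exact_mod_cast (by omega))
  simpa using degree_negDiff_iterate_lt h1

theorem negDiff_iterate_ratioPoly_top (a n : ℕ) :
    (negDiff^[2 * a + 5] (ratioPoly a)).eval (n : ℝ) = -((2 * a + 5).factorial : ℝ) := by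
  have h1 : (taylor (n : ℝ) (ratioPoly a)).natDegree = 2 * a + 5 := by
    rw [natDegree_taylor, natDegree_ratioPoly]
  have h2 := sum_alternating_choose_eval h1.le
  have h3 : (taylor (n : ℝ) (ratioPoly a)).coeff (2 * a + 5) = 1 := by
    rw [← h1, coeff_natDegree, leadingCoeff_taylor]
    exact monic_ratioPoly a
  have hs : (-1 : ℝ) ^ (2 * a + 5) = -1 := Odd.neg_one_pow ⟨a + 2, by ring⟩
  rw [h3, hs] at h2
  rw [negDiff_iterate_eval]
  simp only [taylor_eval] at h2
  simp only [add_comm (n : ℝ), h2]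
  ring

/-- Since $(-N)_k/k!=(-1)^k\binom Nk$, and the remaining factors are the value of `ratioPoly` at
$n+k$ over a constant, the sum is an $N$-th difference. -/
theorem sum_poch_mul_invGamma (a n N : ℕ) :
    ∑ k ∈ Icc 0 N, poch (-(N : ℝ)) k * poch ((n : ℝ) + a + 3) k * poch ((n : ℝ) + a + 4) k *
      invGamma ((n : ℝ) + k) * invGamma ((n : ℝ) + k + 2) / (k.factorial : ℝ) =
    (negDiff^[N] (ratioPoly a)).eval (n : ℝ) /
      (((n + a + 2).factorial : ℝ) * ((n + a + 3).factorial : ℝ)) := by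
  have hI : Icc 0 N = range (N + 1) := by
    ext j
    simp
  rw [negDiff_iterate_eval, sum_div, hI]
  refine sum_congr rfl fun k _ => ?_
  have e1 := poch_three (n + a) k
  have e2 := poch_four (n + a) k
  have e3 := invGamma_natCast (n + k)
  have e4 := invGamma_natCast_add_one (n + k + 1)
  rw [← recipFact_zero] at e4
  push_cast at e1 e2 e3 e4
  rw [add_assoc, show (1 : ℝ) + 1 = 2 by norm_num] at e4
  rw [poch_neg_natCast, e1, e2, e3, e4, ← Nat.cast_add, ratioPoly_eval,
    ← factorial_mul_recipFact (a := n + k + a + 2) (s := 1) (b := n + k) (by omega),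
    ← factorial_mul_recipFact (a := n + k + a + 3) (s := 0) (b := n + k + 1) (by omega),
    show n + a + 2 + k = n + k + a + 2 by ring, show n + a + 3 + k = n + k + a + 3 by ring]
  have h1 : (k.factorial : ℝ) ≠ 0 := by positivity
  field_simp

/-- The common form of the summands of `γ_{j+N}^{(3)}` and `γ_{j+N}^{(4)}` with index `j`. -/
noncomputable def diffTerm (a : ℕ) (r : ℕ → ℝ) (x : ℝ) (j N : ℕ) : ℝ :=
  (-1) ^ j * x ^ j / (j.factorial : ℝ) * ∑ n ∈ range (j + 1), (-1) ^ n * (j.choose n : ℝ) *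
    (r n * (((n + a + 2 + N).choose N : ℝ) * (negDiff^[N] (ratioPoly a)).eval (n : ℝ)))

theorem diffTerm_of_right_lt {a : ℕ} (r : ℕ → ℝ) (x : ℝ) (j N : ℕ) (h : 2 * a + 5 < N) :
    diffTerm a r x j N = 0 := by
  simp [diffTerm, negDiff_iterate_ratioPoly_eq_zero h]

/-- The sum over `n` is a $j$-th difference, which kills polynomials of degree at most $D<j$. -/
theorem diffTerm_of_left_lt {a D : ℕ} {r : ℕ → ℝ} (x : ℝ)
    (hr : ∀ N, N ≤ 2 * a + 5 → ∃ q : ℝ[X], q.natDegree ≤ D ∧ ∀ n : ℕ,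
      r n * (((n + a + 2 + N).choose N : ℝ) * (negDiff^[N] (ratioPoly a)).eval (n : ℝ)) =
        q.eval (n : ℝ))
    (j N : ℕ) (h : D < j) : diffTerm a r x j N = 0 := by
  rcases Nat.lt_or_ge (2 * a + 5) N with hN | hN
  · exact diffTerm_of_right_lt r x j N hN
  · obtain ⟨q, hq, hqr⟩ := hr N hN
    simp only [diffTerm, hqr]
    rw [sum_alternating_choose_eval (hq.trans h.le),
      coeff_eq_zero_of_natDegree_lt (hq.trans_lt h), mul_zero, mul_zero]

/-- The sum over `N` vanishes for each `n` separately, whatever `r` is: Newton's formula moves the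
argument from $n$ to $-a-3$, independently of `n`, and this is a root of `ratioPoly`. -/
theorem sum_diffTerm (a : ℕ) (r : ℕ → ℝ) (x : ℝ) (j : ℕ) :
    ∑ N ∈ range (2 * a + 5 + 1), diffTerm a r x j N = 0 := by
  simp only [diffTerm]
  rw [← mul_sum, sum_comm, sum_eq_zero, mul_zero]
  intro n _
  rw [← mul_sum, ← mul_sum]
  have h := sum_choose_negDiff_iterate_eval (2 * a + 6) (n + a + 2) (degree_ratioPoly_lt a) n
  push_cast at h
  rw [show (n : ℝ) - (n + a + 2) - 1 = -a - 3 by ring, ratioPoly_eval_neg] at h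
  rw [h, mul_zero, mul_zero]

theorem diffTerm_one_top (a : ℕ) (x : ℝ) :
    diffTerm a (fun _ => 1) x (2 * a + 5) (2 * a + 5) = -x ^ (2 * a + 5) := by
  have h := sum_alternating_choose_descFactorial_self (2 * a + 5) (a + 2 + (2 * a + 5))
  have h1 : ∀ n : ℕ, (1 : ℝ) * (((n + a + 2 + (2 * a + 5)).choose (2 * a + 5) : ℝ) *
      (negDiff^[2 * a + 5] (ratioPoly a)).eval (n : ℝ)) =
      -((n + (a + 2 + (2 * a + 5))).descFactorial (2 * a + 5) : ℝ) := by
    intro n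
    rw [negDiff_iterate_ratioPoly_top, Nat.descFactorial_eq_factorial_mul_choose,
      show n + (a + 2 + (2 * a + 5)) = n + a + 2 + (2 * a + 5) by ring]
    push_cast
    ring
  simp only [diffTerm, h1, mul_neg, sum_neg_distrib]
  rw [h]
  have hs : (-1 : ℝ) ^ (2 * a + 5) = -1 := Odd.neg_one_pow ⟨a + 2, by ring⟩
  have h2 : ((2 * a + 5).factorial : ℝ) ≠ 0 := by positivity
  rw [hs]
  field_simp

theorem exists_poly_of_one (a N : ℕ) (hN : N ≤ 2 * a + 5) :
    ∃ q : ℝ[X], q.natDegree ≤ 2 * a + 5 ∧ ∀ n : ℕ,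
      1 * (((n + a + 2 + N).choose N : ℝ) * (negDiff^[N] (ratioPoly a)).eval (n : ℝ)) =
        q.eval (n : ℝ) := by
  refine ⟨C (1 / (N.factorial : ℝ)) * (fallPoly (a + 2 + N) N * negDiff^[N] (ratioPoly a)),
    ?_, fun n => ?_⟩
  · refine (natDegree_C_mul_le _ _).trans (natDegree_mul_le.trans ?_)
    have := natDegree_negDiff_iterate_ratioPoly_le hN
    rw [natDegree_fallPoly]
    omega
  · rw [eval_mul, eval_mul, eval_C, fallPoly_eval, Nat.descFactorial_eq_factorial_mul_choose,
      show n + (a + 2 + N) = n + a + 2 + N by ring]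
    have : (N.factorial : ℝ) ≠ 0 := by positivity
    push_cast
    field_simp

/-- The denominator $n+a+3$ divides the polynomial, so the degree drops by one; this is why
$\gamma^{(3)}$ already vanishes at $4a+10$. -/
theorem exists_poly_of_inv (a N : ℕ) (hN : N ≤ 2 * a + 5) :
    ∃ q : ℝ[X], q.natDegree ≤ 2 * a + 4 ∧ ∀ n : ℕ,
      1 / ((n : ℝ) + a + 3) *
        (((n + a + 2 + N).choose N : ℝ) * (negDiff^[N] (ratioPoly a)).eval (n : ℝ)) =
        q.eval (n : ℝ) := by
  rcases N with _ | N
  -- For $N=0$ the denominator cancels the top factor of the second falling factorial of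
  -- `ratioPoly`.
  · refine ⟨fallPoly (a + 2) (a + 3) * fallPoly (a + 2) (a + 1), ?_, fun n => ?_⟩
    · refine natDegree_mul_le.trans ?_
      rw [natDegree_fallPoly, natDegree_fallPoly]
      omega
    · have h : (n : ℝ) + a + 3 ≠ 0 := by positivity
      rw [Function.iterate_zero, id, ratioPoly_eval, eval_mul, fallPoly_eval, fallPoly_eval,
        Nat.succ_descFactorial_succ (n + a + 2) (a + 1), ← add_assoc, Nat.choose_zero_right]
      push_cast
      field_simp
      ring
  -- For positive order it cancels the lowest factor in the numerator of the binomial coefficient.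
  · refine ⟨C (1 / ((N + 1).factorial : ℝ)) *
      (fallPoly (a + 3 + N) N * negDiff^[N + 1] (ratioPoly a)), ?_, fun n => ?_⟩
    · refine (natDegree_C_mul_le _ _).trans (natDegree_mul_le.trans ?_)
      have := natDegree_negDiff_iterate_ratioPoly_le hN
      rw [natDegree_fallPoly]
      omega
    · have h : (n : ℝ) + a + 3 ≠ 0 := by positivity
      have h1 : ((N + 1).factorial : ℝ) ≠ 0 := by positivity
      have h2 := Nat.descFactorial_eq_factorial_mul_choose (n + a + 2 + (N + 1)) (N + 1)
      rw [Nat.descFactorial_succ, show n + a + 2 + (N + 1) - N = n + a + 3 by omega] at h2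
      have h3 : ((n : ℝ) + a + 3) * ((n + a + 2 + (N + 1)).descFactorial N : ℝ) =
          ((N + 1).factorial : ℝ) * ((n + a + 2 + (N + 1)).choose (N + 1) : ℝ) := by
        exact_mod_cast h2
      rw [eval_mul, eval_mul, eval_C, fallPoly_eval,
        show n + (a + 3 + N) = n + a + 2 + (N + 1) by ring]
      field_simp
      linear_combination -(negDiff^[N + 1] (ratioPoly a)).eval (n : ℝ) * h3

theorem gammaCoeff3_eq_diagSum (a i : ℕ) (x : ℝ) :
    gammaCoeff3 a i x = 2 / (((a : ℝ) + 1) * (a + 3) * ((a + 2).factorial : ℝ) ^ 2) *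
      diagSum (diffTerm a (fun n => 1 / ((n : ℝ) + a + 3)) x) i := by
  have h : gammaCoeff3 a i x = 2 / (((a : ℝ) + 1) * (a + 3)) *
      diagSum (fun j N => 1 / ((a + 2).factorial : ℝ) ^ 2 *
        diffTerm a (fun n => 1 / ((n : ℝ) + a + 3)) x j N) i := by
    rw [gammaCoeff3]
    congr 1
    refine sum_Icc_eq_diagSum fun j N h => ?_
    subst h
    rw [diffTerm, mul_sum, mul_sum]
    have hI : Icc 0 j = range (j + 1) := by
      ext j
      simp
    rw [hI]
    refine sum_congr rfl fun n _ => ?_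
    have hc : -((j + N : ℕ) : ℝ) + (j : ℝ) = -(N : ℝ) := by
      push_cast
      ring
    have hch := Nat.add_choose_mul_factorial_mul_factorial (n + a + 2) N
    have hch' : ((n + a + 2 + N).choose N : ℝ) * ((n + a + 2).factorial : ℝ) *
        (N.factorial : ℝ) = ((n + a + 2 + N).factorial : ℝ) := by
      exact_mod_cast hch
    rw [Nat.add_sub_cancel_left, hc, sum_poch_mul_invGamma, poch_neg_natCast, poch_three,
      poch_three, show a + 2 + (N + n) = n + a + 2 + N by ring, ← hch',
      Nat.factorial_succ (n + a + 2), show a + 2 + n = n + a + 2 by ring]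
    have h1 : (n : ℝ) + a + 3 ≠ 0 := by positivity
    have h2 : (n : ℝ) + a + 2 + 1 ≠ 0 := by positivity
    push_cast
    field_simp
    ring
  rw [h, diagSum, diagSum, ← mul_sum]
  field_simp

theorem gammaCoeff4_eq_diagSum (a i : ℕ) (x : ℝ) :
    gammaCoeff4 a i x =
      -(2 / (((a : ℝ) + 1) * (a + 4) * ((a + 2).factorial : ℝ) * ((a + 3).factorial : ℝ))) *
        diagSum (diffTerm a (fun _ => 1) x) i := by
  have h : gammaCoeff4 a i x = -(2 / (((a : ℝ) + 1) * (a + 4))) *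
      diagSum (fun j N => 1 / (((a + 2).factorial : ℝ) * ((a + 3).factorial : ℝ)) *
        diffTerm a (fun _ => 1) x j N) i := by
    rw [gammaCoeff4]
    congr 1
    refine sum_Icc_eq_diagSum fun j N h => ?_
    subst h
    rw [diffTerm, mul_sum, mul_sum]
    have hI : Icc 0 j = range (j + 1) := by
      ext j
      simp
    rw [hI]
    refine sum_congr rfl fun n _ => ?_
    have hc : -((j + N : ℕ) : ℝ) + (j : ℝ) = -(N : ℝ) := by
      push_cast
      ring
    have hch := Nat.add_choose_mul_factorial_mul_factorial (n + a + 2) N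
    have hch' : ((n + a + 2 + N).choose N : ℝ) * ((n + a + 2).factorial : ℝ) *
        (N.factorial : ℝ) = ((n + a + 2 + N).factorial : ℝ) := by
      exact_mod_cast hch
    rw [Nat.add_sub_cancel_left, hc, sum_poch_mul_invGamma, poch_neg_natCast, poch_three,
      poch_four, show a + 2 + (N + n) = n + a + 2 + N by ring, ← hch',
      show a + 3 + n = n + a + 3 by ring]
    field_simp
  rw [h, diagSum, diagSum, ← mul_sum]
  field_simp

theorem gammaCoeff3_eq_zero {a i : ℕ} (x : ℝ) (h : 4 * a + 10 ≤ i) : gammaCoeff3 a i x = 0 := by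
  rw [gammaCoeff3_eq_diagSum, diagSum_eq_zero (diffTerm_of_left_lt x (exists_poly_of_inv a))
    (diffTerm_of_right_lt _ x) (by omega), mul_zero]

theorem gammaCoeff4_eq_zero {a i : ℕ} (x : ℝ) (h : 4 * a + 10 < i) : gammaCoeff4 a i x = 0 := by
  rw [gammaCoeff4_eq_diagSum, diagSum_eq_zero (diffTerm_of_left_lt x (exists_poly_of_one a))
    (diffTerm_of_right_lt _ x) (by omega), mul_zero]

theorem gammaCoeff4_top (a : ℕ) (x : ℝ) :
    gammaCoeff4 a (4 * a + 10) x = 2 * x ^ (2 * a + 5) /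
      (((a : ℝ) + 1) * (a + 4) * ((a + 2).factorial : ℝ) * ((a + 3).factorial : ℝ)) := by
  rw [gammaCoeff4_eq_diagSum, show 4 * a + 10 = (2 * a + 5) + (2 * a + 5) by ring,
    diagSum_add_eq (diffTerm_of_left_lt x (exists_poly_of_one a)) (diffTerm_of_right_lt _ x),
    diffTerm_one_top]
  ring

theorem sum_gammaCoeff3 {a M : ℕ} (x : ℝ) (hM : 4 * a + 10 < M) :
    ∑ i ∈ range M, gammaCoeff3 a i x = 0 := by
  simp only [gammaCoeff3_eq_diagSum]
  rw [← mul_sum, sum_range_diagSum (diffTerm_of_left_lt x (exists_poly_of_inv a))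
    (diffTerm_of_right_lt _ x) (by omega), sum_eq_zero fun j _ => sum_diffTerm a _ x j, mul_zero]

theorem sum_gammaCoeff4 {a M : ℕ} (x : ℝ) (hM : 4 * a + 10 < M) :
    ∑ i ∈ range M, gammaCoeff4 a i x = 0 := by
  simp only [gammaCoeff4_eq_diagSum]
  rw [← mul_sum, sum_range_diagSum (diffTerm_of_left_lt x (exists_poly_of_one a))
    (diffTerm_of_right_lt _ x) (by omega), sum_eq_zero fun j _ => sum_diffTerm a _ x j, mul_zero]

/-! ### The coefficients `γ_i` -/

theorem gammaCoeff_eq_zero {a i : ℕ} (x : ℝ) (h : 4 * a + 10 < i) : gammaCoeff a i x = 0 := by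
  rw [gammaCoeff, gammaCoeff1_eq_zero x h, gammaCoeff2_eq_zero x h, gammaCoeff3_eq_zero x h.le,
    gammaCoeff4_eq_zero x h, gammaCoeff5_eq_zero x h]
  simp

theorem gammaCoeff_top (a : ℕ) (x : ℝ) :
    gammaCoeff a (4 * a + 10) x = gammaCoeff5 a (4 * a + 10) x := by
  rw [gammaCoeff, gammaCoeff1_top, gammaCoeff2_top, gammaCoeff3_eq_zero x le_rfl, gammaCoeff4_top]
  have h1 : (a : ℝ) + 1 ≠ 0 := by positivity
  have h2 : (a : ℝ) + 4 ≠ 0 := by positivity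
  field_simp
  ring

/-- The sums over diagonals start at $i=0$, the theorem's at $i=1$; parts 3 and 4 vanish at $i=0$
because $1/\Gamma(0)=0$. -/
theorem gammaCoeff_zero (a : ℕ) (x : ℝ) : gammaCoeff a 0 x = 0 := by
  have h3 : gammaCoeff3 a 0 x = 0 := by
    simp [gammaCoeff3, invGamma]
  have h4 : gammaCoeff4 a 0 x = 0 := by
    simp [gammaCoeff4, invGamma]
  rw [gammaCoeff, h3, h4]
  simp [gammaCoeff1, gammaCoeff2, gammaCoeff5]

theorem sum_gammaCoeff (a : ℕ) (x : ℝ) :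
    ∑ i ∈ range (4 * a + 10), gammaCoeff a (i + 1) x = 0 := by
  have h : ∑ i ∈ range (4 * a + 10 + 1), gammaCoeff a i x = 0 := by
    simp only [gammaCoeff, sum_add_distrib]
    rw [sum_gammaCoeff1 x (Nat.lt_succ_self _), sum_gammaCoeff2 x (Nat.lt_succ_self _),
      sum_gammaCoeff3 x (Nat.lt_succ_self _), sum_gammaCoeff4 x (Nat.lt_succ_self _),
      sum_gammaCoeff5 x (Nat.lt_succ_self _)]
    simp
  rwa [sum_range_succ', gammaCoeff_zero, add_zero] at h

end SobolevLaguerre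

theorem mainTheorem4 (α : ℕ) :
    (∀ i : ℕ, 4 * α + 10 < i → ∀ x : ℝ, SobolevLaguerre.gammaCoeff (α : ℝ) i x = 0) ∧
    (∀ x : ℝ,
      SobolevLaguerre.gammaCoeff (α : ℝ) (4 * α + 10) x =
          SobolevLaguerre.gammaCoeff5 (α : ℝ) (4 * α + 10) x ∧
      SobolevLaguerre.gammaCoeff (α : ℝ) (4 * α + 10) x =
        x ^ (2 * α + 5) /
          (((α : ℝ) + 1) * (2 * (α : ℝ) + 5) * (Nat.factorial (α + 2) : ℝ) *
            (Nat.factorial (α + 3) : ℝ))) ∧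
    (∀ x : ℝ, ∑ i ∈ Finset.Icc 1 (4 * α + 10), SobolevLaguerre.gammaCoeff (α : ℝ) i x = 0) ∧
    (∀ x : ℝ, HasSum (fun i : ℕ => SobolevLaguerre.gammaCoeff (α : ℝ) (i + 1) x) 0) := by
  refine ⟨fun i hi x => SobolevLaguerre.gammaCoeff_eq_zero x hi, fun x => ⟨?_, ?_⟩, fun x => ?_,
    fun x => ?_⟩
  · exact SobolevLaguerre.gammaCoeff_top α x
  · rw [SobolevLaguerre.gammaCoeff_top, SobolevLaguerre.gammaCoeff5_top]
  · have hI : Finset.Icc 1 (4 * α + 10) = Finset.Ico 1 (4 * α + 10 + 1) := by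
      ext j
      simp
    rw [hI, Finset.sum_Ico_eq_sum_range, Nat.add_sub_cancel]
    simp only [add_comm 1]
    exact SobolevLaguerre.sum_gammaCoeff α x
  · rw [← SobolevLaguerre.sum_gammaCoeff α x]
    refine hasSum_sum_of_ne_finset_zero fun i hi => SobolevLaguerre.gammaCoeff_eq_zero x ?_
    rw [Finset.mem_range] at hi
    omega
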